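/- Let $N\ge 1$, $p\ge 2$, $0<s<1$ and $q\ge p$. Write $B_r$ for the open ball of radius $r$ centered at the origin of $\mathbb{R}^N$, $\delta_h^2u(x)=u(x+2h)+u(x)-2u(x+h)$ and $J_p(t)=|t|^{p-2}t$. For an open set $\Omega\subset\mathbb{R}^N$, $W^{s,p}(\Omega)$ is the set of $u\in L^p(\Omega)$ with $\iint_{\Omega\times\Omega}\frac{|u(x)-u(y)|^p}{|x-y|^{N+sp}}\,dx\,dy<\infty$, and $u\in W^{s,p}_{\rm loc}(\Omega)$ means that $u\in W^{s,p}(\Omega')$ for every open $\Omega'$ with compact closure contained in $\Omega$. $L^{p-1}_{sp}(\mathbb{R}^N)$ is the set of $u\in L^{p-1}_{\rm loc}(\mathbb{R}^N)$ with $\int_{\mathbb{R}^N}\frac{|u(x)|^{p-1}}{1+|x|^{N+sp}}\,dx<\infty$. A function $u\in W^{s,p}_{\rm loc}(\Omega)\cap L^{p-1}_{sp}(\mathbb{R}^N)$, with $\Omega$ bounded and open, is a local weak solution of $(-\Delta_p)^su=0$ in $\Omega$ if $$\iint_{\mathbb{R}^N\times\mathbb{R}^N}\frac{J_p(u(x)-u(y))\,(\varphi(x)-\varphi(y))}{|x-y|^{N+sp}}\,dx\,dy=0$$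 for every $\varphi\in W^{s,p}(\Omega)$ with compact support in $\Omega$. **Proposition.** There is a non-increasing function $h_0\mapsto C(h_0)=C(N,s,p,q,h_0)\in(0,\infty)$ on $(0,1/10)$, with $C(h_0)\nearrow+\infty$ as $h_0\searrow0$, such that the following holds. Let $0<h_0<1/10$ and let $u\in W^{s,p}_{\rm loc}(B_2)\cap L^{p-1}_{sp}(\mathbb{R}^N)$ be a local weak solution of $(-\Delta_p)^su=0$ in $B_2$ such that $$\|u\|_{L^\infty(B_1)}\le 1,\qquad \mathrm{Tail}_{p-1,sp}(u;0,1)^{p-1}=\int_{\mathbb{R}^N\setminus B_1}\frac{|u(y)|^{p-1}}{|y|^{N+sp}}\,dy\le 1,\qquad \sup_{0<|h|<h_0}\left\|\frac{\delta_h^2u}{|h|^s}\right\|_{L^q(B_1)}^q<+\infty.$$ Then for every radius $4h_0<R\le 1-5h_0$, $$\sup_{0<|h|<h_0}\left\|\frac{\delta_h^2u}{|h|^s}\right\|_{L^{q+1}(B_{R-4h_0})}^{q+1}\le C(h_0)\left(\sup_{0<|h|<h_0}\left\|\frac{\delta_h^2u}{|h|^s}\right\|_{L^q(B_{R+4h_0})}^q+1\right).$$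 -/

import Mathlib

open MeasureTheory Metric Set Filter Topology
open scoped ENNReal

noncomputable section

namespace FracPLap

/-- `ℝ^N` with its Euclidean norm. -/
abbrev Rn (N : ℕ) : Type := EuclideanSpace ℝ (Fin N)

/-- `J_p(t) = |t|^(p-2) t`. -/
def J (p t : ℝ) : ℝ := |t| ^ (p - 2) * t

/-- The second order difference `δ²_h u(x) = u(x + 2h) + u(x) - 2 u(x + h)`. -/
def secondDiff {N : ℕ} (h : Rn N) (u : Rn N → ℝ) (x : Rn N) : ℝ :=
  u (x + (2 : ℝ) • h) + u x - 2 * u (x + h)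

/-- The `p`-th power of the Sobolev-Slobodeckii seminorm,
`[u]^p_{W^{s,p}(Ω)} = ∬_{Ω × Ω} |u(x) - u(y)|^p / |x - y|^(N + s p) dx dy`. -/
def gagliardoEnergy {N : ℕ} (s p : ℝ) (Ω : Set (Rn N)) (u : Rn N → ℝ) : ℝ≥0∞ :=
  ∫⁻ z in Ω ×ˢ Ω,
    ENNReal.ofReal (|u z.1 - u z.2| ^ p / ‖z.1 - z.2‖ ^ ((N : ℝ) + s * p))

/-- `u ∈ W^{s,p}(Ω)`. -/
def MemW {N : ℕ} (s p : ℝ) (Ω : Set (Rn N)) (u : Rn N → ℝ) : Prop :=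
  MemLp u (ENNReal.ofReal p) (volume.restrict Ω) ∧ gagliardoEnergy s p Ω u < ∞

/-- `u ∈ W^{s,p}_loc(Ω)`: `u ∈ W^{s,p}(Ω')` for every open `Ω'` whose closure is compact and
contained in `Ω`. -/
def MemWLoc {N : ℕ} (s p : ℝ) (Ω : Set (Rn N)) (u : Rn N → ℝ) : Prop :=
  ∀ Ω' : Set (Rn N), IsOpen Ω' → IsCompact (closure Ω') → closure Ω' ⊆ Ω → MemW s p Ω' u

/-- The tail space `L^q_α(ℝ^N)`: functions in `L^q_loc(ℝ^N)` with
`∫ |u|^q / (1 + |x|^(N + α)) dx < ∞`. -/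
def MemTailSpace {N : ℕ} (q α : ℝ) (u : Rn N → ℝ) : Prop :=
  (∀ K : Set (Rn N), IsCompact K → MemLp u (ENNReal.ofReal q) (volume.restrict K)) ∧
    ∫⁻ x, ENNReal.ofReal (|u x| ^ q / (1 + ‖x‖ ^ ((N : ℝ) + α))) < ∞

/-- `Tail_{q,α}(u; x₀, R) = [R^α ∫_{ℝ^N ∖ B_R(x₀)} |u|^q / |x - x₀|^(N + α) dx]^(1/q)`. -/
def tail {N : ℕ} (q α : ℝ) (u : Rn N → ℝ) (x₀ : Rn N) (R : ℝ) : ℝ≥0∞ :=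
  (ENNReal.ofReal (R ^ α) *
    ∫⁻ x in (ball x₀ R)ᶜ, ENNReal.ofReal (|u x| ^ q / ‖x - x₀‖ ^ ((N : ℝ) + α))) ^ (1 / q)

/-- The integrand of the weak form of `(-Δ_p)^s u`,
`J_p(u(x) - u(y)) (φ(x) - φ(y)) / |x - y|^(N + s p)`. -/
def weakIntegrand {N : ℕ} (s p : ℝ) (u φ : Rn N → ℝ) (z : Rn N × Rn N) : ℝ :=
  J p (u z.1 - u z.2) * (φ z.1 - φ z.2) / ‖z.1 - z.2‖ ^ ((N : ℝ) + s * p)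

/-- `u` is a local weak solution of `(-Δ_p)^s u = 0` in the bounded open set `Ω`
(an `(s,p)`-harmonic function): `u ∈ W^{s,p}_loc(Ω) ∩ L^{p-1}_{sp}(ℝ^N)`, and the weak form vanishes
against every `φ ∈ W^{s,p}(Ω)` with compact support in `Ω`. The double integral over `ℝ^N × ℝ^N`
is an absolutely convergent Lebesgue integral for such `u` and `φ`. -/
structure IsLocalWeakSolution {N : ℕ} (s p : ℝ) (Ω : Set (Rn N)) (u : Rn N → ℝ) : Prop where
  memWLoc : MemWLoc s p Ω u
  memTailSpace : MemTailSpace (p - 1) (s * p) u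
  weak_eq : ∀ φ : Rn N → ℝ, MemW s p Ω φ → HasCompactSupport φ → tsupport φ ⊆ Ω →
    ∫ z : Rn N × Rn N, weakIntegrand s p u φ z = 0

/-- `sup_{0 < |h| < h₀} ‖δ²_h u / |h|^s‖^q_{L^q(B_r)}`, with `B_r` centered at the origin. -/
def besovSup {N : ℕ} (s q h₀ r : ℝ) (u : Rn N → ℝ) : ℝ≥0∞ :=
  ⨆ (h : Rn N) (_ : 0 < ‖h‖ ∧ ‖h‖ < h₀),
    eLpNorm (fun x => secondDiff h u x / ‖h‖ ^ s) (ENNReal.ofReal q)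
      (volume.restrict (ball (0 : Rn N) r)) ^ q

end FracPLap

end

noncomputable section

namespace FracPLap

/-! Write `v = u(· + h) - u` and `b = q + 3 - p`. Subtract the equation from its translate by `h`
and test with `J_b(v) ζ²`, where `ζ` is a cutoff. Where `ζ = 1` at both points, monotonicity of
`J_p` times monotonicity of `J_b` bounds the integrand below by a multiple of `|v(x) - v(y)|^(p+b-2)
/ |x - y|^(N+sp)`, and `p + b - 2 = q + 1`. This yields the Caccioppoli inequality
`lintegral_diff_energy_le`. The second difference of `u` is the first difference of `v`, so
`lintegral_translate_sub_le` bounds its `L^(q+1)` norm, to the power `q + 1`, by `|h|^(sp)` times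
the energy of `v`. Since `sp + s(q+1-p) = s(q+1)`, it remains to show that the error terms have size
`|h|^(s(q+1-p))`.

The local error pairs `|v|^b` with the power `p - 2` of differences of `u` and with the squared
variation of `ζ`. Boundedness of `v` lets two powers of `|v|` be dropped, which leaves total degree
`(p-2) + (q+1-p) = q - 1 ≤ q`. After normalising by `|x - y|^s` and `|h|^s`, the product is at most
one plus `q`-th powers; the factor `|h|^(s(q+1-p))` comes out, and the remaining kernel `|x -
y|^(2-2s-N)` is integrable because `s < 1` (`lintegral_local_error_le`). Slicing along `y = x + ξ`
reduces matters to first-order difference quotients of order `s` in `L^q`. These follow from the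
second-order ones by doubling the step, again because `s < 1` (`lintegral_diff_le_of_secondDiff`).

The far error is a product of the tail and the integral of `|v|^(b-1)`, which carries the same power
of `|h|`. All constants are uniform over `h₀ ≥ a`, so a monotone choice of `C` exists
(`exists_antitone_majorant`). -/

/-! ### Pointwise inequalities for `J`. -/

lemma add_rpow_le_two_rpow {x y r : ℝ} (hx : 0 ≤ x) (hy : 0 ≤ y) (hr : 0 ≤ r) :
    (x + y) ^ r ≤ 2 ^ r * (x ^ r + y ^ r) := by
  wlog hxy : y ≤ x generalizing x y
  · rw [add_comm x, add_comm (x ^ r)]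
    exact this hy hx (le_of_not_ge hxy)
  calc (x + y) ^ r ≤ (2 * x) ^ r := Real.rpow_le_rpow (by positivity) (by linarith) hr
    _ = 2 ^ r * x ^ r := Real.mul_rpow (by norm_num) hx
    _ ≤ 2 ^ r * (x ^ r + y ^ r) := by
      gcongr
      linarith [Real.rpow_nonneg hy r]

lemma abs_sub_rpow_le {x y r : ℝ} (hr : 0 ≤ r) :
    |x - y| ^ r ≤ 2 ^ r * (|x| ^ r + |y| ^ r) :=
  (Real.rpow_le_rpow (abs_nonneg _) (abs_sub x y) hr).trans
    (add_rpow_le_two_rpow (abs_nonneg _) (abs_nonneg _) hr)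

lemma abs_rpow_mul_self {r t : ℝ} (hr : 0 ≤ r) : |t| ^ r * |t| = |t| ^ (r + 1) := by
  rcases eq_or_ne t 0 with rfl | ht
  · rw [abs_zero, mul_zero, Real.zero_rpow (by linarith)]
  · rw [Real.rpow_add_one (abs_ne_zero.mpr ht)]

lemma abs_rpow_mul_sq {r t : ℝ} (hr : 0 ≤ r) : |t| ^ r * t ^ 2 = |t| ^ (r + 2) := by
  rw [← sq_abs, pow_two, ← mul_assoc, abs_rpow_mul_self hr, abs_rpow_mul_self (by linarith)]
  congr 1; ring

lemma abs_J {p t : ℝ} (hp : 2 ≤ p) : |J p t| = |t| ^ (p - 1) := by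
  rw [J, abs_mul, abs_of_nonneg (by positivity), abs_rpow_mul_self (by linarith)]
  congr 1; ring

lemma J_neg {p t : ℝ} : J p (-t) = -J p t := by simp [J]

lemma rpow_sub_mul_sq_sub_nonneg {x y r : ℝ} (hr : 0 ≤ r) :
    0 ≤ (|x| ^ r - |y| ^ r) * (x ^ 2 - y ^ 2) := by
  rcases le_total |y| |x| with h | h
  · exact mul_nonneg (sub_nonneg.mpr (Real.rpow_le_rpow (abs_nonneg _) h hr))
      (sub_nonneg.mpr (sq_le_sq.mpr h))
  · exact mul_nonneg_of_nonpos_of_nonpos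
      (sub_nonpos.mpr (Real.rpow_le_rpow (abs_nonneg _) h hr)) (sub_nonpos.mpr (sq_le_sq.mpr h))

/-- The right side equals the left side plus half of `(|x|^(p-2) - |y|^(p-2)) (x² - y²)`, which is
nonnegative. -/
lemma half_weight_le_J_sub_mul {p x y : ℝ} (hp : 2 ≤ p) :
    (|x| ^ (p - 2) + |y| ^ (p - 2)) * (x - y) ^ 2 / 2 ≤ (J p x - J p y) * (x - y) := by
  have h := rpow_sub_mul_sq_sub_nonneg (x := x) (y := y) (r := p - 2) (by linarith)
  unfold J
  nlinarith

lemma J_sub_mul_nonneg {p x y : ℝ} (hp : 2 ≤ p) : 0 ≤ (J p x - J p y) * (x - y) :=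
  le_trans (by positivity) (half_weight_le_J_sub_mul hp)

/-- Strong monotonicity of `J_p`. -/
lemma abs_sub_rpow_le_J_sub_mul {p x y : ℝ} (hp : 2 ≤ p) :
    |x - y| ^ p ≤ 2 ^ (p - 1) * ((J p x - J p y) * (x - y)) := by
  have h1 := half_weight_le_J_sub_mul (x := x) (y := y) hp
  have h2 := abs_sub_rpow_le (x := x) (y := y) (r := p - 2) (by linarith)
  have h3 := abs_rpow_mul_sq (r := p - 2) (t := x - y) (by linarith)
  rw [show p - 2 + 2 = p by ring] at h3
  rw [← h3]
  have h4 : (2 : ℝ) ^ (p - 1) = 2 ^ (p - 2) * 2 := by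
    rw [← Real.rpow_add_one (by norm_num)]; congr 1; ring
  rw [h4]
  calc |x - y| ^ (p - 2) * (x - y) ^ 2
      ≤ 2 ^ (p - 2) * (|x| ^ (p - 2) + |y| ^ (p - 2)) * (x - y) ^ 2 := by gcongr
    _ = 2 ^ (p - 2) * 2 * ((|x| ^ (p - 2) + |y| ^ (p - 2)) * (x - y) ^ 2 / 2) := by ring
    _ ≤ _ := by gcongr

/-- Bernoulli's inequality for `(y/x)^(r+1)`, multiplied by `x^(r+1)`. -/
lemma rpow_sub_rpow_le {x y r : ℝ} (hx : 0 ≤ x) (hy : 0 ≤ y) (hr : 0 ≤ r) :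
    x ^ r * x - y ^ r * y ≤ (r + 1) * x ^ r * (x - y) := by
  rcases hx.eq_or_lt with rfl | hx
  · rcases hr.eq_or_lt with rfl | hr
    · simp
    · have := Real.rpow_nonneg hy r
      rw [Real.zero_rpow hr.ne']
      nlinarith
  · have h := one_add_mul_self_le_rpow_one_add (s := y / x - 1) (by
      have : 0 ≤ y / x := by positivity
      linarith) (p := r + 1) (by linarith)
    rw [show 1 + (y / x - 1) = y / x by ring, Real.div_rpow hy hx.le,
      le_div_iff₀ (by positivity)] at h
    have e1 : x ^ (r + 1) = x ^ r * x := Real.rpow_add_one hx.ne' r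
    have e2 : y ^ (r + 1) = y ^ r * y := by
      have := abs_rpow_mul_self (t := y) hr
      rw [abs_of_nonneg hy] at this
      exact this.symm
    rw [e1, e2] at h
    have e3 : (1 + (r + 1) * (y / x - 1)) * (x ^ r * x)
        = x ^ r * x - (r + 1) * x ^ r * (x - y) := by
      field_simp
      ring
    linarith

lemma abs_J_sub_le_of_nonneg {p x y : ℝ} (hp : 2 ≤ p) (hx : 0 ≤ x) (hy : 0 ≤ y) (hyx : y ≤ x) :
    |J p x - J p y| ≤ (p - 1) * (|x| ^ (p - 2) + |y| ^ (p - 2)) * |x - y| := by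
  have h := rpow_sub_rpow_le hx hy (r := p - 2) (by linarith)
  have hm : y ^ (p - 2) ≤ x ^ (p - 2) := Real.rpow_le_rpow hy hyx (by linarith)
  have hy' := Real.rpow_nonneg hy (p - 2)
  unfold J
  rw [abs_of_nonneg hx, abs_of_nonneg hy, abs_of_nonneg (sub_nonneg.mpr hyx), abs_of_nonneg
    (sub_nonneg.mpr (mul_le_mul hm hyx hy (by positivity)))]
  have : 0 ≤ (p - 1) * y ^ (p - 2) * (x - y) :=
    mul_nonneg (mul_nonneg (by linarith) hy') (by linarith)
  nlinarith

lemma abs_J_sub_le {p x y : ℝ} (hp : 2 ≤ p) :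
    |J p x - J p y| ≤ (p - 1) * (|x| ^ (p - 2) + |y| ^ (p - 2)) * |x - y| := by
  wlog hx : 0 ≤ x generalizing x y
  · have := this (x := -x) (y := -y) (by linarith)
    rw [J_neg, J_neg, abs_neg, abs_neg, ← abs_neg, ← abs_neg (-x - -y)] at this
    convert this using 2 <;> ring_nf
  rcases le_total 0 y with hy | hy
  · rcases le_total y x with h | h
    · exact abs_J_sub_le_of_nonneg hp hx hy h
    · have := abs_J_sub_le_of_nonneg hp hy hx h
      rwa [abs_sub_comm, abs_sub_comm x, add_comm (|x| ^ _)]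
  -- For opposite signs there is no cancellation: the triangle inequality suffices, because `p - 1 ≥
  -- 1`.
  · have h1 : |x - y| = |x| + |y| := by
      rw [abs_of_nonneg hx, abs_of_nonpos hy, abs_of_nonneg (by linarith)]; ring
    have h2 : |J p x - J p y| ≤ |x| ^ (p - 2) * |x| + |y| ^ (p - 2) * |y| := by
      refine (abs_sub _ _).trans (le_of_eq ?_)
      unfold J
      rw [abs_mul, abs_mul, abs_of_nonneg (by positivity : 0 ≤ |x| ^ (p - 2)),
        abs_of_nonneg (by positivity : 0 ≤ |y| ^ (p - 2))]
    rw [h1]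
    have ha := Real.rpow_nonneg (abs_nonneg x) (p - 2)
    have hb := Real.rpow_nonneg (abs_nonneg y) (p - 2)
    have : 1 * ((|x| ^ (p - 2) + |y| ^ (p - 2)) * (|x| + |y|)) ≤
        (p - 1) * ((|x| ^ (p - 2) + |y| ^ (p - 2)) * (|x| + |y|)) := by
      gcongr
      linarith
    nlinarith [mul_nonneg ha (abs_nonneg y), mul_nonneg hb (abs_nonneg x)]

/-- Coercivity of `J` up to an error that is supported where the cutoff varies. -/
lemma neg_le_sub_mul_J_cutoff {b A B m n : ℝ} (hb : 2 ≤ b) :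
    -((|A| ^ b + |B| ^ b) * (m - n) ^ 2) ≤ (A - B) * (J b A * m ^ 2 - J b B * n ^ 2) := by
  have h := rpow_sub_mul_sq_sub_nonneg (x := A) (y := B) (r := b - 2) (by linarith)
  have hA := abs_rpow_mul_sq (r := b - 2) (t := A) (by linarith)
  have hB := abs_rpow_mul_sq (r := b - 2) (t := B) (by linarith)
  rw [show b - 2 + 2 = b by ring] at hA hB
  rw [← hA, ← hB]
  unfold J
  have hx := Real.rpow_nonneg (abs_nonneg A) (b - 2)
  have hy := Real.rpow_nonneg (abs_nonneg B) (b - 2)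
  set x := |A| ^ (b - 2)
  set y := |B| ^ (b - 2)
  -- The sum splits into a monotone part and two quadratic forms in `(A - B)(m + n)`, `(A - B)(m -
  -- n)` and `T(m - n)`, with `T = A` or `T = B`; completing the square makes each form nonnegative.
  have e : (A - B) * (x * A * m ^ 2 - y * B * n ^ 2) + (x * A ^ 2 + y * B ^ 2) * (m - n) ^ 2 =
    (x - y) * (A ^ 2 - B ^ 2) * ((m ^ 2 + n ^ 2) / 4)
    + x * (((A - B) ^ 2 * (m ^ 2 + n ^ 2)) / 4 + A * (A - B) * (m ^ 2 - n ^ 2) / 2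
        + A ^ 2 * (m - n) ^ 2)
    + y * (((A - B) ^ 2 * (m ^ 2 + n ^ 2)) / 4 + B * (A - B) * (m ^ 2 - n ^ 2) / 2
        + B ^ 2 * (m - n) ^ 2) := by ring
  have k : ∀ T : ℝ, 0 ≤ ((A - B) ^ 2 * (m ^ 2 + n ^ 2)) / 4 + T * (A - B) * (m ^ 2 - n ^ 2) / 2
        + T ^ 2 * (m - n) ^ 2 := by
    intro T
    nlinarith [sq_nonneg ((A - B) * (m + n) / 4 + T * (m - n)), sq_nonneg ((A - B) * (m + n)),
      sq_nonneg ((A - B) * (m - n))]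
  have h1 := mul_nonneg hx (k A)
  have h2 := mul_nonneg hy (k B)
  have h3 := mul_nonneg h (by positivity : 0 ≤ (m ^ 2 + n ^ 2) / 4)
  linarith

/-- The quotient `(J p x - J p y) / (x - y)` lies between `0` and the Lipschitz bound of
`abs_J_sub_le`, so it can multiply the inequality for `J b` without changing its direction. -/
lemma neg_le_J_sub_mul_cutoff {p b x y A B m n : ℝ} (hp : 2 ≤ p) (hb : 2 ≤ b)
    (hxy : x - y = A - B) :
    -((p - 1) * (|x| ^ (p - 2) + |y| ^ (p - 2)) * ((|A| ^ b + |B| ^ b) * (m - n) ^ 2)) ≤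
      (J p x - J p y) * (J b A * m ^ 2 - J b B * n ^ 2) := by
  rcases eq_or_ne x y with rfl | hne
  · have : 0 ≤ (p - 1) * (|x| ^ (p - 2) + |x| ^ (p - 2)) * ((|A| ^ b + |B| ^ b) * (m - n) ^ 2) := by
      have : 0 ≤ p - 1 := by linarith
      positivity
    simpa using this
  · have hd : x - y ≠ 0 := sub_ne_zero.mpr hne
    have hl0 : 0 ≤ (J p x - J p y) / (x - y) := by
      have := J_sub_mul_nonneg (x := x) (y := y) hp
      rw [← mul_div_mul_right _ _ hd]
      exact div_nonneg this (mul_self_nonneg _)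
    have hl1 : (J p x - J p y) / (x - y) ≤ (p - 1) * (|x| ^ (p - 2) + |y| ^ (p - 2)) := by
      refine (le_abs_self _).trans ?_
      rw [abs_div, div_le_iff₀ (abs_pos.mpr hd)]
      exact abs_J_sub_le hp
    have key := neg_le_sub_mul_J_cutoff (A := A) (B := B) (m := m) (n := n) hb
    have e : (J p x - J p y) * (J b A * m ^ 2 - J b B * n ^ 2) =
        (J p x - J p y) / (x - y) * ((A - B) * (J b A * m ^ 2 - J b B * n ^ 2)) := by
      rw [← hxy]; field_simp
    rw [e]
    have h1 := mul_le_mul_of_nonneg_left key hl0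
    have h2 : (J p x - J p y) / (x - y) * ((|A| ^ b + |B| ^ b) * (m - n) ^ 2) ≤
      (p - 1) * (|x| ^ (p - 2) + |y| ^ (p - 2)) * ((|A| ^ b + |B| ^ b) * (m - n) ^ 2) := by gcongr
    linarith

/-- Multiply the strong monotonicity of `J p` and of `J b` and cancel the common factor `(A - B)²`.
With `x - y = u(x+h) - u(y+h) - (u(x) - u(y))` and `A - B` the difference of `δ_h u`, the two
increments coincide. -/
lemma abs_sub_rpow_le_J_sub_mul_J_sub {p b x y A B : ℝ} (hp : 2 ≤ p) (hb : 2 ≤ b)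
    (hxy : x - y = A - B) :
    |A - B| ^ (p + b - 2) ≤ 2 ^ (p + b - 2) * ((J p x - J p y) * (J b A - J b B)) := by
  rcases eq_or_ne A B with rfl | hne
  · simp [Real.zero_rpow (by linarith : p + b - 2 ≠ 0)]
  · have hd : 0 < (A - B) ^ 2 := by
      have := sub_ne_zero.mpr hne
      positivity
    have h1 := abs_sub_rpow_le_J_sub_mul (x := x) (y := y) hp
    have h2 := abs_sub_rpow_le_J_sub_mul (x := A) (y := B) hb
    rw [hxy] at h1
    have h3 := mul_le_mul h1 h2 (by positivity) (le_trans (by positivity) h1)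
    have e1 : |A - B| ^ p * |A - B| ^ b = |A - B| ^ (p + b - 2) * (A - B) ^ 2 := by
      rw [abs_rpow_mul_sq (by linarith), ← Real.rpow_add (abs_pos.mpr (sub_ne_zero.mpr hne))]
      congr 1; ring
    have e2 : (2 : ℝ) ^ (p + b - 2) = 2 ^ (p - 1) * 2 ^ (b - 1) := by
      rw [← Real.rpow_add (by norm_num)]; congr 1; ring
    rw [e1] at h3
    rw [e2]
    refine le_of_mul_le_mul_right (h3.trans (le_of_eq ?_)) hd
    ring

lemma rpow_le_one_add_rpow {x a b : ℝ} (hx : 0 ≤ x) (ha : 0 ≤ a) (hab : a ≤ b) :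
    x ^ a ≤ 1 + x ^ b := by
  rcases le_total x 1 with h | h
  · linarith [Real.rpow_le_one hx h ha, Real.rpow_nonneg hx b]
  · linarith [Real.rpow_le_rpow_of_exponent_le h hab]

lemma rpow_mul_rpow_le {x y a b c : ℝ} (hx : 0 ≤ x) (hy : 0 ≤ y) (ha : 0 ≤ a) (hb : 0 ≤ b)
    (hc : a + b ≤ c) : x ^ a * y ^ b ≤ 1 + x ^ c + y ^ c := by
  rcases le_total x y with h | h
  · have h1 : x ^ a * y ^ b ≤ y ^ a * y ^ b := by gcongr
    rw [← Real.rpow_add_of_nonneg hy ha hb] at h1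
    linarith [rpow_le_one_add_rpow hy (by linarith) hc, Real.rpow_nonneg hx c]
  · have h1 : x ^ a * y ^ b ≤ x ^ a * x ^ b := by gcongr
    rw [← Real.rpow_add_of_nonneg hx ha hb] at h1
    linarith [rpow_le_one_add_rpow hx (by linarith) hc, Real.rpow_nonneg hy c]

lemma abs_J_cutoff_sub_le {b A B m n : ℝ} (hb : 2 ≤ b) (hA : |A| ≤ 2) (hB : |B| ≤ 2)
    (hm0 : 0 ≤ m) (hm : m ≤ 1) (hn0 : 0 ≤ n) (hn : n ≤ 1) :
    |J b A * m ^ 2 - J b B * n ^ 2| ≤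
      2 * (b - 1) * 2 ^ (b - 2) * |A - B| + 2 ^ b * |m - n| := by
  have e : J b A * m ^ 2 - J b B * n ^ 2 =
      (J b A - J b B) * m ^ 2 + J b B * ((m - n) * (m + n)) := by ring
  have h1 := abs_J_sub_le (x := A) (y := B) hb
  have h2 : |A| ^ (b - 2) ≤ 2 ^ (b - 2) := Real.rpow_le_rpow (abs_nonneg _) hA (by linarith)
  have h3 : |B| ^ (b - 2) ≤ 2 ^ (b - 2) := Real.rpow_le_rpow (abs_nonneg _) hB (by linarith)
  have h4 : |J b B| ≤ 2 ^ (b - 1) := by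
    rw [abs_J hb]
    exact Real.rpow_le_rpow (abs_nonneg _) hB (by linarith)
  have h5 : (2 : ℝ) ^ b = 2 ^ (b - 1) * 2 := by
    rw [← Real.rpow_add_one (by norm_num)]; congr 1; ring
  have hb1 : 0 ≤ b - 1 := by linarith
  rw [e]
  refine (abs_add_le _ _).trans (add_le_add ?_ ?_)
  · rw [abs_mul, abs_of_nonneg (sq_nonneg m)]
    calc |J b A - J b B| * m ^ 2 ≤ |J b A - J b B| * 1 := by
          gcongr
          nlinarith
      _ ≤ (b - 1) * (2 ^ (b - 2) + 2 ^ (b - 2)) * |A - B| := by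
          rw [mul_one]
          refine h1.trans ?_
          gcongr
      _ = _ := by ring
  · rw [abs_mul, abs_mul, abs_of_nonneg (add_nonneg hm0 hn0), h5]
    calc |J b B| * (|m - n| * (m + n)) ≤ 2 ^ (b - 1) * (|m - n| * 2) := by
          gcongr
          linarith
      _ = _ := by ring

/-! ### Singular kernels, slicing and averaging. -/

/-- In polar coordinates the Jacobian `y^(N-1)` turns the integrand into `y^(α-1)`, integrable at
`0` for `α > 0`. -/
lemma lintegral_norm_rpow_ball_lt_top {N : ℕ} (hN : 1 ≤ N) {α : ℝ} (hα : 0 < α) (r : ℝ) :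
    ∫⁻ ξ in ball (0 : Rn N) r, ENNReal.ofReal (‖ξ‖ ^ (α - N)) < ∞ := by
  have : Nonempty (Fin N) := ⟨⟨0, hN⟩⟩
  have h : IntegrableOn (fun ξ : Rn N => ‖ξ‖ ^ (α - N)) (ball 0 r) := by
    rw [integrableOn_fun_norm_addHaar volume (f := fun y : ℝ => y ^ (α - N))]
    rcases le_or_gt r 0 with hr | hr
    · simp [Ioo_eq_empty_of_le hr]
    refine IntegrableOn.congr_fun (f := fun y : ℝ => y ^ (α - 1))
      ((intervalIntegral.integrableOn_Ioo_rpow_iff hr).mpr (by linarith)) ?_ measurableSet_Ioo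
    intro y hy
    simp only [finrank_euclideanSpace, Fintype.card_fin, smul_eq_mul]
    rw [← Real.rpow_natCast, ← Real.rpow_add hy.1]
    congr 1
    push_cast [Nat.cast_sub hN]
    ring
  have := h.2
  rw [hasFiniteIntegral_iff_ofReal (Eventually.of_forall fun x => by positivity)] at this
  exact this

/-- Under the measure-preserving change `(x, y) = (x, x + ξ)` the kernel depends on `ξ` alone, and
two points of the unit ball differ by less than `2`. A bound on translates, uniform in `ξ`, thus
controls a double integral. -/
lemma lintegral_prod_self_le_of_slices {N : ℕ} {α : ℝ} {E : Set (Rn N)} (hE : MeasurableSet E)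
    (hE1 : E ⊆ ball 0 1) {f : Rn N × Rn N → ℝ≥0∞} (hf : Measurable f) {M : ℝ≥0∞}
    (hM : ∀ ξ, ∫⁻ x in {x | x ∈ E ∧ x + ξ ∈ E}, f (x, x + ξ) ≤ M) :
    ∫⁻ z in E ×ˢ E, f z * ENNReal.ofReal (‖z.1 - z.2‖ ^ (α - N)) ≤
      M * ∫⁻ ξ in ball (0 : Rn N) 2, ENNReal.ofReal (‖ξ‖ ^ (α - N)) := by
  have hmk : Measurable fun z : Rn N × Rn N => ENNReal.ofReal (‖z.1 - z.2‖ ^ (α - N)) := by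
    fun_prop
  have hG : Measurable ((E ×ˢ E).indicator
      fun z : Rn N × Rn N => f z * ENNReal.ofReal (‖z.1 - z.2‖ ^ (α - N))) :=
    (hf.mul hmk).indicator (hE.prod hE)
  have hmp := measurePreserving_prod_add (volume : Measure (Rn N)) (volume : Measure (Rn N))
  rw [← lintegral_indicator (hE.prod hE), Measure.volume_eq_prod, ← hmp.lintegral_comp hG,
    lintegral_prod_symm' _ (by exact hG.comp hmp.measurable), ← lintegral_const_mul _ (by fun_prop),
    ← lintegral_indicator measurableSet_ball]
  refine lintegral_mono fun ξ => ?_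
  have hS : MeasurableSet {x | x ∈ E ∧ x + ξ ∈ E} :=
    hE.inter ((measurable_add_const ξ) hE)
  have e : (fun x => (E ×ˢ E).indicator
      (fun z : Rn N × Rn N => f z * ENNReal.ofReal (‖z.1 - z.2‖ ^ (α - N))) (x, x + ξ)) =
      {x | x ∈ E ∧ x + ξ ∈ E}.indicator
        fun x => f (x, x + ξ) * ENNReal.ofReal (‖ξ‖ ^ (α - N)) := by
    ext x
    by_cases hx : x ∈ E ∧ x + ξ ∈ E
    · rw [indicator_of_mem (show (x, x + ξ) ∈ E ×ˢ E from hx),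
        indicator_of_mem (show x ∈ {x | x ∈ E ∧ x + ξ ∈ E} from hx)]
      simp
    · rw [indicator_of_notMem (show (x, x + ξ) ∉ E ×ˢ E from hx),
        indicator_of_notMem (show x ∉ {x | x ∈ E ∧ x + ξ ∈ E} from hx)]
  simp only [e]
  rw [lintegral_indicator hS, lintegral_mul_const _ (by fun_prop)]
  by_cases hξ : ξ ∈ ball (0 : Rn N) 2
  · rw [indicator_of_mem hξ]
    gcongr
    exact hM ξ
  · have : {x | x ∈ E ∧ x + ξ ∈ E} = ∅ := by
      refine eq_empty_of_forall_notMem fun x hx => hξ ?_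
      have h1 := hE1 hx.1
      have h2 := hE1 hx.2
      rw [mem_ball_zero_iff] at *
      calc ‖ξ‖ = ‖(x + ξ) - x‖ := by congr 1; abel
        _ ≤ ‖x + ξ‖ + ‖x‖ := norm_sub_le _ _
        _ < 2 := by linarith
    simp [this]

lemma ofReal_abs_rpow_le_kernel {X : Type*} [NormedAddCommGroup X] (w : X → ℝ) {e m ρ : ℝ}
    (he : 0 < e) (hm : 0 ≤ m) {x y : X} (hxy : ‖x - y‖ ≤ ρ) :
    ENNReal.ofReal (|w x - w y| ^ e) ≤
      ENNReal.ofReal (ρ ^ m) * ENNReal.ofReal (|w x - w y| ^ e / ‖x - y‖ ^ m) := by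
  rcases eq_or_ne x y with rfl | hne
  · simp [Real.zero_rpow he.ne']
  have hpos : 0 < ‖x - y‖ := norm_pos_iff.mpr (sub_ne_zero.mpr hne)
  rw [← ENNReal.ofReal_mul (Real.rpow_nonneg (hpos.le.trans hxy) _)]
  apply ENNReal.ofReal_le_ofReal
  rw [mul_div_assoc', le_div_iff₀ (by positivity), mul_comm]
  gcongr

/-- Translations are controlled by the fractional energy, by averaging over a ball of radius
`‖h‖`. -/
lemma lintegral_translate_sub_le (N : ℕ) {e t : ℝ} (he : 0 < e) (ht : 0 ≤ t) :
    ∃ K : ℝ≥0∞, K < ∞ ∧ ∀ (w : Rn N → ℝ), Measurable w → ∀ (h : Rn N), h ≠ 0 → ∀ (r d : ℝ),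
      ‖h‖ ≤ d →
      ∫⁻ x in ball (0 : Rn N) r, ENNReal.ofReal (|w (x + h) - w x| ^ e) ≤
        K * ENNReal.ofReal (‖h‖ ^ t) * ∫⁻ z in ball (0 : Rn N) (r + d) ×ˢ ball (0 : Rn N) (r + d),
          ENNReal.ofReal (|w z.1 - w z.2| ^ e / ‖z.1 - z.2‖ ^ ((N : ℝ) + t)) := by
  set V : ℝ≥0∞ := volume (ball (0 : Rn N) 1) with hV
  have hV0 : V ≠ 0 := (measure_ball_pos _ _ one_pos).ne'
  have hVt : V ≠ ∞ := measure_ball_lt_top.ne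
  refine ⟨2 * ENNReal.ofReal (2 ^ e * 2 ^ ((N : ℝ) + t)) / V, ENNReal.div_lt_top
    (ENNReal.mul_ne_top (by simp) ENNReal.ofReal_ne_top) hV0, ?_⟩
  intro w hw h hh r d hd
  set E := ball (0 : Rn N) (r + d) with hE
  have hEm : MeasurableSet E := measurableSet_ball
  have hh0 : 0 < ‖h‖ := norm_pos_iff.mpr hh
  set Φ : Rn N × Rn N → ℝ≥0∞ := fun z =>
    ENNReal.ofReal (|w z.1 - w z.2| ^ e / ‖z.1 - z.2‖ ^ ((N : ℝ) + t)) with hΦ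
  have hΦm : Measurable Φ := by fun_prop
  set Ψ : Rn N → ℝ≥0∞ := fun x => ∫⁻ z in E, Φ (x, z) with hΨ
  have hΨm : Measurable Ψ := hΦm.lintegral_prod_right'
  have hI : ∫⁻ z in E ×ˢ E, Φ z = ∫⁻ x in E, Ψ x := by
    rw [Measure.volume_eq_prod, setLIntegral_prod _ hΦm.aemeasurable]
  set c : ℝ≥0∞ := ENNReal.ofReal (2 ^ e) * ENNReal.ofReal ((2 * ‖h‖) ^ ((N : ℝ) + t)) with hc
  set vol := volume (ball (0 : Rn N) ‖h‖) with hvol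
  have hvol0 : vol ≠ 0 := (measure_ball_pos _ _ hh0).ne'
  have hvolt : vol ≠ ∞ := measure_ball_lt_top.ne
  have hpt : ∀ x ∈ ball (0 : Rn N) r,
      vol * ENNReal.ofReal (|w (x + h) - w x| ^ e) ≤ c * (Ψ (x + h) + Ψ x) := by
    intro x hx
    have hsub : ball x ‖h‖ ⊆ E := by
      intro z hz
      rw [hE, mem_ball_zero_iff]
      rw [mem_ball_zero_iff] at hx
      rw [mem_ball, dist_eq_norm] at hz
      calc ‖z‖ = ‖x + (z - x)‖ := by abel_nf
        _ ≤ ‖x‖ + ‖z - x‖ := norm_add_le _ _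
        _ < r + d := by linarith
    have hvx : vol = volume (ball x ‖h‖) := by
      rw [hvol, Measure.addHaar_ball_center volume x]
    calc vol * ENNReal.ofReal (|w (x + h) - w x| ^ e)
        = ∫⁻ z in ball x ‖h‖, ENNReal.ofReal (|w (x + h) - w x| ^ e) := by
          rw [setLIntegral_const, hvx, mul_comm]
      -- Each `z` in this ball is within `2‖h‖` of both `x` and `x + h`. This produces `‖h‖^(N+t)`,
      -- from which the volume of the ball takes away `‖h‖^N`.
      _ ≤ ∫⁻ z in ball x ‖h‖, c * (Φ (x + h, z) + Φ (x, z)) := by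
          refine setLIntegral_mono (by fun_prop) fun z hz => ?_
          rw [mem_ball, dist_eq_norm] at hz
          have h1 : ‖x + h - z‖ ≤ 2 * ‖h‖ := by
            calc ‖x + h - z‖ = ‖h - (z - x)‖ := by congr 1; abel
              _ ≤ ‖h‖ + ‖z - x‖ := norm_sub_le _ _
              _ ≤ 2 * ‖h‖ := by linarith
          have h2 : ‖x - z‖ ≤ 2 * ‖h‖ := by rw [norm_sub_rev]; linarith
          have k1 := ofReal_abs_rpow_le_kernel w he (m := (N : ℝ) + t) (by positivity) h1
          have k2 := ofReal_abs_rpow_le_kernel w he (m := (N : ℝ) + t) (by positivity) h2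
          calc ENNReal.ofReal (|w (x + h) - w x| ^ e)
              ≤ ENNReal.ofReal (2 ^ e * (|w (x + h) - w z| ^ e + |w x - w z| ^ e)) := by
                apply ENNReal.ofReal_le_ofReal
                have := abs_sub_rpow_le (x := w (x + h) - w z) (y := w x - w z) he.le
                rwa [sub_sub_sub_cancel_right] at this
            _ = ENNReal.ofReal (2 ^ e) * (ENNReal.ofReal (|w (x + h) - w z| ^ e) +
                  ENNReal.ofReal (|w x - w z| ^ e)) := by
                rw [ENNReal.ofReal_mul (by positivity), ENNReal.ofReal_add (by positivity)
                  (by positivity)]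
            _ ≤ c * (Φ (x + h, z) + Φ (x, z)) := by
                rw [hc, mul_assoc, mul_add (ENNReal.ofReal ((2 * ‖h‖) ^ _))]
                gcongr
      _ ≤ ∫⁻ z in E, c * (Φ (x + h, z) + Φ (x, z)) := lintegral_mono_set hsub
      _ = c * (Ψ (x + h) + Ψ x) := by
          rw [lintegral_const_mul _ (by fun_prop), lintegral_add_left (by fun_prop)]
  have hshift : ∫⁻ x in ball (0 : Rn N) r, Ψ (x + h) ≤ ∫⁻ x in E, Ψ x := by
    rw [← lintegral_indicator hEm, ← lintegral_indicator measurableSet_ball,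
      ← lintegral_add_right_eq_self (E.indicator Ψ) h]
    refine lintegral_mono fun x => ?_
    refine indicator_le' (f := fun x => Ψ (x + h)) (g := fun x => E.indicator Ψ (x + h))
      (fun x hx => ?_) (fun _ _ => zero_le) x
    rw [indicator_of_mem]
    rw [hE, mem_ball_zero_iff]
    rw [mem_ball_zero_iff] at hx
    exact (norm_add_le _ _).trans_lt (by linarith)
  have hmono : ∫⁻ x in ball (0 : Rn N) r, Ψ x ≤ ∫⁻ x in E, Ψ x :=
    lintegral_mono_set (ball_subset_ball (by linarith))
  have hmain : vol * ∫⁻ x in ball (0 : Rn N) r, ENNReal.ofReal (|w (x + h) - w x| ^ e) ≤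
      c * (2 * ∫⁻ x in E, Ψ x) := by
    rw [← lintegral_const_mul _ (by fun_prop)]
    calc _ ≤ ∫⁻ x in ball (0 : Rn N) r, c * (Ψ (x + h) + Ψ x) :=
          setLIntegral_mono (by fun_prop) hpt
      _ = c * ((∫⁻ x in ball (0 : Rn N) r, Ψ (x + h)) + ∫⁻ x in ball (0 : Rn N) r, Ψ x) := by
          rw [lintegral_const_mul _ (by fun_prop), lintegral_add_left (by fun_prop)]
      _ ≤ _ := by rw [two_mul]; exact mul_le_mul_right (add_le_add hshift hmono) _
  have hvolV : vol = ENNReal.ofReal (‖h‖ ^ (N : ℝ)) * V := by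
    rw [hvol, Measure.addHaar_ball_of_pos _ _ hh0]
    simp [hV]
  have hfin : c * 2 = vol * (2 * ENNReal.ofReal (2 ^ e * 2 ^ ((N : ℝ) + t)) / V *
      ENNReal.ofReal (‖h‖ ^ t)) := by
    have e1 : c = ENNReal.ofReal (2 ^ e * 2 ^ ((N : ℝ) + t)) * ENNReal.ofReal (‖h‖ ^ (N : ℝ)) *
        ENNReal.ofReal (‖h‖ ^ t) := by
      rw [hc, ← ENNReal.ofReal_mul (by positivity), ← ENNReal.ofReal_mul (by positivity),
        ← ENNReal.ofReal_mul (by positivity), Real.mul_rpow (by norm_num) hh0.le,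
        Real.rpow_add hh0]
      congr 1; ring
    rw [hvolV, e1, div_eq_mul_inv]
    calc _ = V * V⁻¹ * (ENNReal.ofReal (2 ^ e * 2 ^ ((N : ℝ) + t)) *
          ENNReal.ofReal (‖h‖ ^ (N : ℝ)) * ENNReal.ofReal (‖h‖ ^ t) * 2) := by
          rw [ENNReal.mul_inv_cancel hV0 hVt, one_mul]
      _ = _ := by ring
  rw [← mul_assoc, hfin, mul_assoc] at hmain
  rw [hI]
  exact (ENNReal.mul_le_mul_iff_right hvol0 hvolt).mp hmain

/-! ### From second-order to first-order differences. -/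

/-- Passes between integrals and norms: the doubling argument needs the triangle inequality with
constant one, since a factor `2^q` would destroy the contraction. -/
lemma lintegral_div_rpow_le_iff {X : Type*} [MeasurableSpace X] {μ : Measure X} (f : X → ℝ)
    {s q c A : ℝ} (hq : 0 < q) (hc : 0 < c) (hA : 0 ≤ A) :
    ∫⁻ x, ENNReal.ofReal (|f x| ^ q / c ^ (s * q)) ∂μ ≤ ENNReal.ofReal (A ^ q) ↔
      eLpNorm f (ENNReal.ofReal q) μ ≤ ENNReal.ofReal (A * c ^ s) := by
  have e1 : eLpNorm f (ENNReal.ofReal q) μ ^ q = ∫⁻ x, ENNReal.ofReal (|f x| ^ q) ∂μ := by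
    rw [eLpNorm_eq_lintegral_rpow_enorm_toReal (by simpa using hq) ENNReal.ofReal_ne_top,
      ENNReal.toReal_ofReal hq.le, ← ENNReal.rpow_mul, one_div_mul_cancel hq.ne', ENNReal.rpow_one]
    refine lintegral_congr fun x => ?_
    rw [Real.enorm_eq_ofReal_abs, ENNReal.ofReal_rpow_of_nonneg (abs_nonneg _) hq.le]
  have hcp : 0 < c ^ (s * q) := by positivity
  have e2 : ∫⁻ x, ENNReal.ofReal (|f x| ^ q / c ^ (s * q)) ∂μ =
      (∫⁻ x, ENNReal.ofReal (|f x| ^ q) ∂μ) / ENNReal.ofReal (c ^ (s * q)) := by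
    simp_rw [ENNReal.ofReal_div_of_pos hcp, div_eq_mul_inv]
    rw [lintegral_mul_const' _ _ (ENNReal.inv_ne_top.mpr (by simpa using hcp))]
  rw [e2, ← e1, ENNReal.div_le_iff (by simpa using hcp) ENNReal.ofReal_ne_top,
    ← ENNReal.rpow_le_rpow_iff hq (x := eLpNorm _ _ _),
    ENNReal.ofReal_rpow_of_nonneg (by positivity) hq.le, Real.mul_rpow hA (by positivity),
    ← Real.rpow_mul hc.le, ENNReal.ofReal_mul (by positivity)]

lemma eLpNorm_diff_le {N : ℕ} {q : ℝ} (hq : 1 ≤ q) {v : Rn N → ℝ} (hv : Measurable v)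
    (μ : Measure (Rn N)) (h : Rn N) :
    eLpNorm (fun x => v (x + h) - v x) (ENNReal.ofReal q) μ ≤
      ENNReal.ofReal (1 / 2) *
        eLpNorm (fun x => v (x + (2 : ℝ) • h) - v x) (ENNReal.ofReal q) μ +
      ENNReal.ofReal (1 / 2) * eLpNorm (secondDiff h v) (ENNReal.ofReal q) μ := by
  have e : (fun x => v (x + h) - v x) =
      ((1 / 2 : ℝ) • fun x => v (x + (2 : ℝ) • h) - v x) - (1 / 2 : ℝ) • secondDiff h v := by
    ext x
    simp only [Pi.sub_apply, Pi.smul_apply, smul_eq_mul, secondDiff]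
    ring
  have hm : Measurable (secondDiff h v) := by unfold secondDiff; fun_prop
  rw [e]
  refine (eLpNorm_sub_le (by fun_prop) (by fun_prop) (by simpa using hq)).trans (le_of_eq ?_)
  rw [eLpNorm_const_smul, eLpNorm_const_smul, Real.enorm_eq_ofReal_abs,
    abs_of_nonneg (by norm_num)]

/-- First order differences of order `s < 1` are controlled by the second order ones. -/
lemma lintegral_diff_le_of_secondDiff (N : ℕ) {s q a : ℝ} (hs0 : 0 < s) (hs1 : s < 1)
    (hq : 1 ≤ q) (ha : 0 < a) :
    ∃ K : ℝ≥0∞, K < ∞ ∧ ∀ h₀, a ≤ h₀ → ∀ v : Rn N → ℝ, Measurable v →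
      (∀ x ∈ ball (0 : Rn N) 1, |v x| ≤ 1) → ∀ ρ, ρ + h₀ ≤ 1 → ∀ S : ℝ≥0∞, S < ∞ →
      (∀ h : Rn N, 0 < ‖h‖ → ‖h‖ < h₀ → ∫⁻ x in ball (0 : Rn N) ρ,
        ENNReal.ofReal (|secondDiff h v x| ^ q / ‖h‖ ^ (s * q)) ≤ S) →
      ∀ ξ : Rn N, 0 < ‖ξ‖ → ‖ξ‖ < h₀ → ∫⁻ x in ball (0 : Rn N) ρ,
        ENNReal.ofReal (|v (x + ξ) - v x| ^ q / ‖ξ‖ ^ (s * q)) ≤ K * (S + 1) := by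
  have hq0 : 0 < q := by linarith
  set V : ℝ := (volume (ball (0 : Rn N) 1)).toReal with hV
  have hVt : volume (ball (0 : Rn N) 1) = ENNReal.ofReal V :=
    (ENNReal.ofReal_toReal measure_ball_lt_top.ne).symm
  have hV0 : 0 ≤ V := ENNReal.toReal_nonneg
  set B : ℝ := (V * 2 ^ q) ^ (1 / q) / (a / 2) ^ s with hB
  have hB0 : 0 ≤ B := by positivity
  have hθ : 0 < 2 - (2 : ℝ) ^ s := by
    have := Real.rpow_lt_rpow_of_exponent_lt (x := 2) (by norm_num) hs1
    rw [Real.rpow_one] at this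
    linarith
  set θ := 2 - (2 : ℝ) ^ s with hθd
  refine ⟨ENNReal.ofReal (2 ^ q * ((1 / θ) ^ q + B ^ q)), ENNReal.ofReal_lt_top, ?_⟩
  intro h₀ hah v hv hvb ρ hρ S hS hSd ξ hξ0 hξ
  set σ := S.toReal ^ (1 / q) with hσ
  have hσ0 : 0 ≤ σ := by positivity
  have hσq : σ ^ q = S.toReal := by
    rw [hσ, ← Real.rpow_mul ENNReal.toReal_nonneg, one_div_mul_cancel hq0.ne', Real.rpow_one]
  have hSσ : S = ENNReal.ofReal (σ ^ q) := by rw [hσq, ENNReal.ofReal_toReal hS.ne]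
  -- Chosen so that `σ ≤ θ A`, that is `A 2^s / 2 + σ / 2 ≤ A`: the bound with constant `A` survives
  -- halving the step. The term `B` covers steps of length at least `h₀ / 2`.
  set A := σ / θ + B with hA
  have hA0 : 0 ≤ A := by positivity
  set μ : Measure (Rn N) := volume.restrict (ball 0 ρ) with hμ
  have hsecond : ∀ h : Rn N, 0 < ‖h‖ → ‖h‖ < h₀ →
      eLpNorm (secondDiff h v) (ENNReal.ofReal q) μ ≤ ENNReal.ofReal (σ * ‖h‖ ^ s) := by
    intro h hh0 hh
    rw [← lintegral_div_rpow_le_iff _ hq0 hh0 hσ0, ← hSσ]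
    exact hSd h hh0 hh
  have hbase : ∀ h : Rn N, 0 < ‖h‖ → ‖h‖ < h₀ → h₀ / 2 ≤ ‖h‖ →
      eLpNorm (fun x => v (x + h) - v x) (ENNReal.ofReal q) μ ≤ ENNReal.ofReal (A * ‖h‖ ^ s) := by
    intro h hh0 hh hh2
    rw [← lintegral_div_rpow_le_iff _ hq0 hh0 hA0]
    calc ∫⁻ x in ball (0 : Rn N) ρ, ENNReal.ofReal (|v (x + h) - v x| ^ q / ‖h‖ ^ (s * q))
        ≤ ∫⁻ x in ball (0 : Rn N) ρ, ENNReal.ofReal (2 ^ q / (a / 2) ^ (s * q)) := by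
          refine setLIntegral_mono (by fun_prop) fun x hx => ?_
          rw [mem_ball_zero_iff] at hx
          have h1 := hvb (x + h) (by
            rw [mem_ball_zero_iff]
            exact (norm_add_le _ _).trans_lt (by linarith))
          have h2 := hvb x (by rw [mem_ball_zero_iff]; linarith)
          apply ENNReal.ofReal_le_ofReal
          gcongr
          · exact (abs_sub _ _).trans (by linarith)
          · linarith
      _ ≤ ENNReal.ofReal (2 ^ q / (a / 2) ^ (s * q)) * ENNReal.ofReal V := by
          rw [setLIntegral_const, ← hVt]
          gcongr
          linarith
      _ = ENNReal.ofReal (B ^ q) := by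
          have i1 : 0 ≤ V * 2 ^ q := by positivity
          have i2 : 0 ≤ a / 2 := by positivity
          rw [← ENNReal.ofReal_mul (by positivity), hB,
            Real.div_rpow (Real.rpow_nonneg i1 _) (Real.rpow_nonneg i2 _), ← Real.rpow_mul i1,
            one_div_mul_cancel hq0.ne', Real.rpow_one, ← Real.rpow_mul i2]
          congr 1; ring
      _ ≤ ENNReal.ofReal (A ^ q) := by
          apply ENNReal.ofReal_le_ofReal
          gcongr
          rw [hA]
          linarith [show 0 ≤ σ / θ by positivity]
  -- Induction on the number of doublings needed to reach length `h₀ / 2`. The ball of integration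
  -- stays fixed because both sides of the identity use the same base point.
  have hstep : ∀ (k : ℕ) (h : Rn N), 0 < ‖h‖ → ‖h‖ < h₀ → h₀ / 2 ≤ 2 ^ k * ‖h‖ →
      eLpNorm (fun x => v (x + h) - v x) (ENNReal.ofReal q) μ ≤ ENNReal.ofReal (A * ‖h‖ ^ s) := by
    intro k
    induction k with
    | zero => intro h hh0 hh hk; exact hbase h hh0 hh (by simpa using hk)
    | succ k ih =>
      intro h hh0 hh hk
      rcases le_or_gt (h₀ / 2) ‖h‖ with hle | hlt
      · exact hbase h hh0 hh hle
      have hn : ‖(2 : ℝ) • h‖ = 2 * ‖h‖ := by rw [norm_smul]; norm_num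
      have h1 := ih ((2 : ℝ) • h) (by rw [hn]; linarith) (by rw [hn]; linarith)
        (by rw [hn]; rw [pow_succ] at hk; linarith)
      rw [hn, Real.mul_rpow (by norm_num) hh0.le] at h1
      refine (eLpNorm_diff_le hq hv μ h).trans ?_
      calc _ ≤ ENNReal.ofReal (1 / 2) * ENNReal.ofReal (A * (2 ^ s * ‖h‖ ^ s)) +
            ENNReal.ofReal (1 / 2) * ENNReal.ofReal (σ * ‖h‖ ^ s) := by
            gcongr
            exact hsecond h hh0 hh
        _ = ENNReal.ofReal (1 / 2 * (A * (2 ^ s * ‖h‖ ^ s)) + 1 / 2 * (σ * ‖h‖ ^ s)) := by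
            rw [← ENNReal.ofReal_mul (by norm_num), ← ENNReal.ofReal_mul (by norm_num),
              ← ENNReal.ofReal_add (by positivity) (by positivity)]
        _ ≤ _ := by
            apply ENNReal.ofReal_le_ofReal
            have hAθ : σ ≤ θ * A := by
              rw [hA, mul_add, mul_div_cancel₀ _ hθ.ne']
              linarith [mul_nonneg hθ.le hB0]
            have := mul_le_mul_of_nonneg_right hAθ (by positivity : 0 ≤ ‖h‖ ^ s)
            rw [hθd] at this
            linarith
  obtain ⟨k, hk⟩ := pow_unbounded_of_one_lt (h₀ / 2 / ‖ξ‖) (one_lt_two (α := ℝ))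
  have h1 := hstep k ξ hξ0 hξ (by rw [div_lt_iff₀ hξ0] at hk; exact hk.le)
  rw [← lintegral_div_rpow_le_iff _ hq0 hξ0 hA0] at h1
  refine h1.trans ?_
  have h2 : A ^ q ≤ 2 ^ q * ((1 / θ) ^ q + B ^ q) * (σ ^ q + 1) := by
    refine (add_rpow_le_two_rpow (by positivity) hB0 hq0.le).trans ?_
    rw [div_eq_mul_one_div, Real.mul_rpow hσ0 (by positivity), mul_assoc]
    have i1 : 0 ≤ (1 / θ) ^ q := by positivity
    have i2 : 0 ≤ B ^ q := by positivity
    have i3 : 0 ≤ σ ^ q := by positivity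
    gcongr
    nlinarith
  refine (ENNReal.ofReal_le_ofReal h2).trans (le_of_eq ?_)
  rw [ENNReal.ofReal_mul (by positivity), ENNReal.ofReal_add (by positivity) (by norm_num), ← hSσ,
    ENNReal.ofReal_one]

/-! ### Tail weights and interactions with far points. -/

/-- The decaying weight `(1 + |y|)^(-m)`. -/
def weight {N : ℕ} (m : ℝ) (y : Rn N) : ℝ := (1 + ‖y‖) ^ (-m)

lemma weight_nonneg {N : ℕ} (m : ℝ) (y : Rn N) : 0 ≤ weight m y := by
  unfold weight; positivity

@[fun_prop]
lemma measurable_weight {N : ℕ} (m : ℝ) : Measurable (weight (N := N) m) := by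
  unfold weight; fun_prop

lemma lintegral_weight_lt_top {N : ℕ} {m : ℝ} (hm : N < m) :
    ∫⁻ y : Rn N, ENNReal.ofReal (weight m y) < ∞ :=
  finite_integral_one_add_norm (by simpa using hm)

lemma inv_rpow_le_weight {N : ℕ} {m d : ℝ} (hm : 0 ≤ m) (hd : 0 < d) {x y : Rn N}
    (hx : ‖x‖ < 1) (hxy : d ≤ ‖x - y‖) :
    (‖x - y‖ ^ m)⁻¹ ≤ (1 + 2 / d) ^ m * weight m y := by
  have hpos : 0 < ‖x - y‖ := hd.trans_le hxy
  have h1 : 1 + ‖y‖ ≤ (1 + 2 / d) * ‖x - y‖ := by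
    have h2 : ‖y‖ ≤ ‖x‖ + ‖x - y‖ := by
      calc ‖y‖ = ‖x - (x - y)‖ := by congr 1; abel
        _ ≤ _ := norm_sub_le _ _
    have h3 : 2 ≤ 2 / d * ‖x - y‖ := by
      rw [div_mul_eq_mul_div, le_div_iff₀ hd]
      linarith
    linarith
  have h2 : (1 + ‖y‖) ^ m ≤ (1 + 2 / d) ^ m * ‖x - y‖ ^ m := by
    rw [← Real.mul_rpow (by positivity) hpos.le]
    exact Real.rpow_le_rpow (by positivity) h1 hm
  rw [weight, Real.rpow_neg (by positivity), ← div_eq_mul_inv, inv_eq_one_div,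
    div_le_div_iff₀ (by positivity) (by positivity), one_mul]
  exact h2

lemma weight_le_translate {N : ℕ} {m : ℝ} (hm : 0 ≤ m) {y h : Rn N} (hh : ‖h‖ ≤ 1) :
    weight m y ≤ 2 ^ m * weight m (y + h) := by
  have h1 : 1 + ‖y + h‖ ≤ 2 * (1 + ‖y‖) := by
    linarith [norm_add_le y h, norm_nonneg y]
  have h2 : (1 + ‖y + h‖) ^ m ≤ 2 ^ m * (1 + ‖y‖) ^ m := by
    rw [← Real.mul_rpow (by positivity) (by positivity)]
    exact Real.rpow_le_rpow (by positivity) h1 hm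
  rw [weight, weight, Real.rpow_neg (by positivity), Real.rpow_neg (by positivity),
    ← div_eq_mul_inv, inv_eq_one_div, div_le_div_iff₀ (by positivity) (by positivity), one_mul]
  exact h2

/-- Symmetrized product of a function supported in `A` and a weight; it dominates the nonlocal
contributions. -/
def offDiag {N : ℕ} (A : Set (Rn N)) (a b : Rn N → ℝ≥0∞) (z : Rn N × Rn N) : ℝ≥0∞ :=
  A.indicator a z.1 * b z.2 + b z.1 * A.indicator a z.2

lemma measurable_offDiag {N : ℕ} {A : Set (Rn N)} (hA : MeasurableSet A) {a b : Rn N → ℝ≥0∞}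
    (ha : Measurable a) (hb : Measurable b) : Measurable (offDiag A a b) := by
  unfold offDiag
  have := ha.indicator hA
  fun_prop

lemma lintegral_offDiag {N : ℕ} {A : Set (Rn N)} (hA : MeasurableSet A) {a b : Rn N → ℝ≥0∞}
    (ha : Measurable a) (hb : Measurable b) :
    ∫⁻ z, offDiag A a b z = 2 * ((∫⁻ x in A, a x) * ∫⁻ y, b y) := by
  have := ha.indicator hA
  unfold offDiag
  rw [lintegral_add_left (by fun_prop), Measure.volume_eq_prod,
    lintegral_prod_mul this.aemeasurable hb.aemeasurable,
    lintegral_prod_mul hb.aemeasurable this.aemeasurable, lintegral_indicator hA]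
  ring

/-- Off `E ×ˢ E`, a pair where `F` does not vanish has exactly one point in `A` and the other
outside `E`; symmetry reduces the two cases to one. -/
lemma le_offDiag {N : ℕ} {A E : Set (Rn N)} (hAE : A ⊆ E) {a b : Rn N → ℝ≥0∞}
    {F : Rn N × Rn N → ℝ≥0∞} (hsym : ∀ x y, F (x, y) = F (y, x))
    (h0 : ∀ x y, x ∉ A → y ∉ A → F (x, y) = 0)
    (hfar : ∀ x y, x ∈ A → y ∉ E → F (x, y) ≤ a x * b y) {z : Rn N × Rn N} (hz : z ∉ E ×ˢ E) :
    F z ≤ offDiag A a b z := by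
  obtain ⟨x, y⟩ := z
  unfold offDiag
  by_cases hx : x ∈ A
  · have hy : y ∉ E := fun hy => hz ⟨hAE hx, hy⟩
    simp only [indicator_of_mem hx]
    exact (hfar x y hx hy).trans le_self_add
  · by_cases hy : y ∈ A
    · have hx' : x ∉ E := fun hx => hz ⟨hx, hAE hy⟩
      simp only [indicator_of_mem hy]
      rw [hsym, mul_comm (b x)]
      exact (hfar y x hy hx').trans le_add_self
    · rw [h0 x y hx hy]
      exact zero_le

lemma lintegral_lt_top_of_offDiag {N : ℕ} {A E : Set (Rn N)} (hA : MeasurableSet A)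
    (hE : MeasurableSet E) (hAE : A ⊆ E) (hA1 : A ⊆ ball 0 1) {b : Rn N → ℝ≥0∞}
    (hb : Measurable b) (hbt : ∫⁻ y, b y < ∞)
    {F : Rn N × Rn N → ℝ≥0∞} (hsym : ∀ x y, F (x, y) = F (y, x))
    (h0 : ∀ x y, x ∉ A → y ∉ A → F (x, y) = 0)
    (hfar : ∀ x y, x ∈ A → y ∉ E → F (x, y) ≤ b y) (hFE : ∫⁻ z in E ×ˢ E, F z < ∞) :
    ∫⁻ z, F z < ∞ := by
  have hle : ∀ z, F z ≤ (E ×ˢ E).indicator F z + offDiag A (fun _ => 1) b z := by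
    intro z
    by_cases hz : z ∈ E ×ˢ E
    · rw [indicator_of_mem hz]
      exact le_self_add
    · exact (le_offDiag hAE hsym h0 (by simpa using hfar) hz).trans le_add_self
  have hAt : volume A < ∞ := (measure_mono hA1).trans_lt measure_ball_lt_top
  calc ∫⁻ z, F z ≤ ∫⁻ z, ((E ×ˢ E).indicator F z + offDiag A (fun _ => 1) b z) := lintegral_mono hle
    _ = (∫⁻ z, (E ×ˢ E).indicator F z) + ∫⁻ z, offDiag A (fun _ => 1) b z :=
        lintegral_add_right _ (measurable_offDiag hA measurable_const hb)
    _ < ∞ := by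
      rw [lintegral_indicator (hE.prod hE), lintegral_offDiag hA measurable_const hb,
        setLIntegral_const, one_mul]
      exact ENNReal.add_lt_top.mpr ⟨hFE, ENNReal.mul_lt_top (by simp) (ENNReal.mul_lt_top hAt hbt)⟩

lemma sub_le_norm_sub {N : ℕ} {ρ R : ℝ} {x y : Rn N} (hx : x ∈ ball (0 : Rn N) ρ)
    (hy : y ∉ ball (0 : Rn N) R) : R - ρ ≤ ‖x - y‖ := by
  rw [mem_ball_zero_iff] at *
  have : ‖y‖ ≤ ‖x‖ + ‖x - y‖ := by
    calc ‖y‖ = ‖x - (x - y)‖ := by congr 1; abel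
      _ ≤ _ := norm_sub_le _ _
  linarith

/-! ### Admissible test functions and absolute convergence. -/

/-- The gap `R - ρ` keeps the kernel nonsingular between the support of `φ` and the complement of
the larger ball, so energy known on `B_R` suffices for testing on `B_2`. -/
lemma gagliardoEnergy_univ_lt_top {N : ℕ} {s p ρ R M : ℝ} (hs : 0 < s) (hp : 2 ≤ p)
    (hρR : ρ < R) (hR : R ≤ 1) {φ : Rn N → ℝ} (hM : ∀ x, |φ x| ≤ M)
    (h0 : ∀ x ∉ ball (0 : Rn N) ρ, φ x = 0)
    (hφE : gagliardoEnergy s p (ball 0 R) φ < ∞) : gagliardoEnergy s p univ φ < ∞ := by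
  have hp0 : p ≠ 0 := by linarith
  have hsp : 0 < s * p := mul_pos hs (by linarith)
  have hm : 0 ≤ (N : ℝ) + s * p := by positivity
  unfold gagliardoEnergy at *
  rw [univ_prod_univ, setLIntegral_univ]
  set b : Rn N → ℝ≥0∞ := fun y => ENNReal.ofReal (M ^ p * (1 + 2 / (R - ρ)) ^ ((N : ℝ) + s * p)) *
    ENNReal.ofReal (weight ((N : ℝ) + s * p) y) with hb
  have hd : 0 < R - ρ := by linarith
  have hM0 : 0 ≤ M := (abs_nonneg _).trans (hM 0)
  refine lintegral_lt_top_of_offDiag (A := ball 0 ρ) (E := ball 0 R) measurableSet_ball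
    measurableSet_ball (ball_subset_ball hρR.le) (ball_subset_ball (by linarith)) (b := b)
    (by fun_prop) ?_ ?_ ?_ ?_ hφE
  · rw [hb, lintegral_const_mul _ (by fun_prop)]
    exact ENNReal.mul_lt_top ENNReal.ofReal_lt_top (lintegral_weight_lt_top (by linarith))
  · intro x y
    simp only [abs_sub_comm (φ x), norm_sub_rev x]
  · intro x y hx hy
    simp [h0 x hx, h0 y hy, Real.zero_rpow hp0]
  · intro x y hx hy
    have hy' : y ∉ ball (0 : Rn N) ρ := fun h => hy (ball_subset_ball hρR.le h)
    rw [hb]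
    simp only [h0 y hy', sub_zero]
    rw [← ENNReal.ofReal_mul (by positivity)]
    apply ENNReal.ofReal_le_ofReal
    rw [div_eq_mul_inv, mul_assoc]
    gcongr
    · exact hM x
    · refine inv_rpow_le_weight hm hd ?_ (sub_le_norm_sub hx hy)
      rw [mem_ball_zero_iff] at hx
      linarith

/-- Near the diagonal a crude Young inequality uses the energies of `v` and `φ`; away from it,
boundedness of `φ` and the tail of `v` suffice. Integrability is what allows two equations to be
subtracted. -/
lemma integrable_weakIntegrand {N : ℕ} {s p ρ R M : ℝ} (hs : 0 < s) (hp : 2 ≤ p)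
    (hρR : ρ < R) (hR : R ≤ 1) {v φ : Rn N → ℝ} (hv : Measurable v) (hφ : Measurable φ)
    (hvb : ∀ x ∈ ball (0 : Rn N) R, |v x| ≤ 1)
    (hvE : gagliardoEnergy s p (ball 0 R) v < ∞)
    (hvT : ∫⁻ y, ENNReal.ofReal (|v y| ^ (p - 1) * weight ((N : ℝ) + s * p) y) < ∞)
    (hM : ∀ x, |φ x| ≤ M) (h0 : ∀ x ∉ ball (0 : Rn N) ρ, φ x = 0)
    (hφE : gagliardoEnergy s p (ball 0 R) φ < ∞) :
    Integrable (weakIntegrand s p v φ) := by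
  have hsp : 0 < s * p := mul_pos hs (by linarith)
  have hd : 0 < R - ρ := by linarith
  have hM0 : 0 ≤ M := (abs_nonneg _).trans (hM 0)
  set m : ℝ := (N : ℝ) + s * p with hm
  have hm0 : 0 ≤ m := by positivity
  have hmeas : Measurable (weakIntegrand s p v φ) := by
    unfold weakIntegrand J
    fun_prop
  refine ⟨hmeas.aestronglyMeasurable, ?_⟩
  rw [hasFiniteIntegral_iff_norm]
  have habs : ∀ x y, ‖weakIntegrand s p v φ (x, y)‖ =
      |v x - v y| ^ (p - 1) * |φ x - φ y| * (‖x - y‖ ^ m)⁻¹ := by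
    intro x y
    rw [weakIntegrand, Real.norm_eq_abs, abs_div, abs_mul, abs_J hp, div_eq_mul_inv,
      abs_of_nonneg (by positivity : 0 ≤ ‖x - y‖ ^ m)]
  set b : Rn N → ℝ≥0∞ := fun y =>
    ENNReal.ofReal (2 ^ (p - 1) * M * (1 + 2 / (R - ρ)) ^ m) *
      (ENNReal.ofReal (weight m y) + ENNReal.ofReal (|v y| ^ (p - 1) * weight m y)) with hb
  refine lintegral_lt_top_of_offDiag (A := ball 0 ρ) (E := ball 0 R) measurableSet_ball
    measurableSet_ball (ball_subset_ball hρR.le) (ball_subset_ball (by linarith)) (b := b)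
    (by fun_prop) ?_ ?_ ?_ ?_ ?_
  · rw [hb, lintegral_const_mul _ (by fun_prop), lintegral_add_left (by fun_prop)]
    exact ENNReal.mul_lt_top ENNReal.ofReal_lt_top
      (ENNReal.add_lt_top.mpr ⟨lintegral_weight_lt_top (by linarith), hvT⟩)
  · intro x y
    rw [habs, habs, abs_sub_comm (φ x), norm_sub_rev x, abs_sub_comm (v x)]
  · intro x y hx hy
    rw [habs]
    simp [h0 x hx, h0 y hy]
  · intro x y hx hy
    have hy' : y ∉ ball (0 : Rn N) ρ := fun h => hy (ball_subset_ball hρR.le h)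
    rw [habs, hb]
    simp only [h0 y hy', sub_zero]
    have hw := weight_nonneg m y
    rw [← ENNReal.ofReal_add hw (by positivity), ← ENNReal.ofReal_mul (by positivity)]
    apply ENNReal.ofReal_le_ofReal
    have hx1 : ‖x‖ < 1 := by
      rw [mem_ball_zero_iff] at hx
      linarith
    have k1 := inv_rpow_le_weight hm0 hd hx1 (sub_le_norm_sub hx hy)
    have k2 : |v x - v y| ^ (p - 1) ≤ 2 ^ (p - 1) * (1 + |v y| ^ (p - 1)) := by
      refine (abs_sub_rpow_le (by linarith)).trans ?_
      gcongr
      exact Real.rpow_le_one (abs_nonneg _) (hvb x (ball_subset_ball hρR.le hx)) (by linarith)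
    calc |v x - v y| ^ (p - 1) * |φ x| * (‖x - y‖ ^ m)⁻¹
        ≤ 2 ^ (p - 1) * (1 + |v y| ^ (p - 1)) * M * ((1 + 2 / (R - ρ)) ^ m * weight m y) := by
          gcongr
          exact hM x
      _ = _ := by ring
  · have : ∀ z, ENNReal.ofReal ‖weakIntegrand s p v φ z‖ ≤
        ENNReal.ofReal (|v z.1 - v z.2| ^ p / ‖z.1 - z.2‖ ^ m) +
        ENNReal.ofReal (|φ z.1 - φ z.2| ^ p / ‖z.1 - z.2‖ ^ m) := by
      rintro ⟨x, y⟩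
      rw [habs, ← ENNReal.ofReal_add (by positivity) (by positivity)]
      apply ENNReal.ofReal_le_ofReal
      rw [← add_div, div_eq_mul_inv]
      gcongr
      rcases le_total |v x - v y| |φ x - φ y| with h | h
      · have h1 := abs_rpow_mul_self (t := φ x - φ y) (r := p - 1) (by linarith)
        rw [sub_add_cancel] at h1
        have h2 : |v x - v y| ^ (p - 1) ≤ |φ x - φ y| ^ (p - 1) :=
          Real.rpow_le_rpow (abs_nonneg _) h (by linarith)
        have h3 := mul_le_mul_of_nonneg_right h2 (abs_nonneg (φ x - φ y))
        linarith [Real.rpow_nonneg (abs_nonneg (v x - v y)) p]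
      · have h1 := abs_rpow_mul_self (t := v x - v y) (r := p - 1) (by linarith)
        rw [sub_add_cancel] at h1
        have h3 := mul_le_mul_of_nonneg_left h
          (Real.rpow_nonneg (abs_nonneg (v x - v y)) (p - 1))
        linarith [Real.rpow_nonneg (abs_nonneg (φ x - φ y)) p]
    refine (lintegral_mono this).trans_lt ?_
    rw [lintegral_add_left (by fun_prop)]
    exact ENNReal.add_lt_top.mpr ⟨hvE, hφE⟩

/-! ### The cutoff and the test function. -/

/-- A Lipschitz cutoff that is `1` on `B_{ρ - d}` and vanishes off `B_ρ`. -/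
def cutoff {N : ℕ} (ρ d : ℝ) (x : Rn N) : ℝ := max 0 (min 1 ((ρ - ‖x‖) / d))

@[fun_prop]
lemma measurable_cutoff {N : ℕ} (ρ d : ℝ) : Measurable (cutoff (N := N) ρ d) := by
  unfold cutoff; fun_prop

lemma cutoff_nonneg {N : ℕ} (ρ d : ℝ) (x : Rn N) : 0 ≤ cutoff ρ d x := le_max_left _ _

lemma cutoff_le_one {N : ℕ} (ρ d : ℝ) (x : Rn N) : cutoff ρ d x ≤ 1 :=
  max_le zero_le_one (min_le_left _ _)

lemma cutoff_eq_zero {N : ℕ} {ρ d : ℝ} (hd : 0 < d) {x : Rn N} (hx : x ∉ ball (0 : Rn N) ρ) :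
    cutoff ρ d x = 0 := by
  rw [mem_ball_zero_iff, not_lt] at hx
  exact max_eq_left ((min_le_right _ _).trans (div_nonpos_of_nonpos_of_nonneg (by linarith) hd.le))

lemma cutoff_eq_one {N : ℕ} {ρ d : ℝ} (hd : 0 < d) {x : Rn N} (hx : x ∈ ball (0 : Rn N) (ρ - d)) :
    cutoff ρ d x = 1 := by
  rw [mem_ball_zero_iff] at hx
  have : 1 ≤ (ρ - ‖x‖) / d := by rw [le_div_iff₀ hd]; linarith
  rw [cutoff, min_eq_left this, max_eq_right zero_le_one]

lemma abs_cutoff_sub_le {N : ℕ} {ρ d : ℝ} (hd : 0 < d) (x y : Rn N) :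
    |cutoff ρ d x - cutoff ρ d y| ≤ ‖x - y‖ / d := by
  have h1 : |cutoff ρ d x - cutoff ρ d y| ≤ |(ρ - ‖x‖) / d - (ρ - ‖y‖) / d| := by
    unfold cutoff
    rw [max_comm 0, max_comm 0]
    refine (abs_max_sub_max_le_abs _ _ _).trans ?_
    refine (abs_min_sub_min_le_max _ _ _ _).trans ?_
    rw [sub_self, abs_zero, max_eq_right (abs_nonneg _)]
  refine h1.trans ?_
  rw [← sub_div, abs_div, abs_of_pos hd]
  gcongr
  rw [sub_sub_sub_cancel_left, norm_sub_rev]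
  exact abs_norm_sub_norm_le _ _

/-- The test function `J_b(δ_h u) ζ²`. -/
def testFn {N : ℕ} (b ρ d : ℝ) (h : Rn N) (u : Rn N → ℝ) (x : Rn N) : ℝ :=
  J b (u (x + h) - u x) * cutoff ρ d x ^ 2

@[fun_prop]
lemma measurable_J (p : ℝ) : Measurable (J p) := by
  unfold J; fun_prop

@[fun_prop]
lemma measurable_testFn {N : ℕ} {b ρ d : ℝ} {h : Rn N} {u : Rn N → ℝ} (hu : Measurable u) :
    Measurable (testFn b ρ d h u) := by
  unfold testFn; fun_prop

/-! ### Regular solutions and the discretely differentiated equation. -/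

/-- Measurable, pointwise bounded solutions with controlled tail. -/
structure RegularSolution {N : ℕ} (s p : ℝ) (T : ℝ≥0∞) (u : Rn N → ℝ) : Prop where
  measurable : Measurable u
  bound : ∀ x ∈ ball (0 : Rn N) 1, |u x| ≤ 1
  energy : gagliardoEnergy s p (ball 0 1) u < ∞
  tail_le : ∫⁻ y, ENNReal.ofReal (|u y| ^ (p - 1) * weight ((N : ℝ) + s * p) y) ≤ T
  weak_eq : ∀ φ : Rn N → ℝ, MemW s p (ball 0 2) φ → HasCompactSupport φ → tsupport φ ⊆ ball 0 2 →
    ∫ z : Rn N × Rn N, weakIntegrand s p u φ z = 0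

lemma gagliardoEnergy_mono {N : ℕ} {s p : ℝ} {Ω Ω' : Set (Rn N)} (h : Ω ⊆ Ω') (u : Rn N → ℝ) :
    gagliardoEnergy s p Ω u ≤ gagliardoEnergy s p Ω' u :=
  lintegral_mono_set (prod_mono h h)

lemma isAddRightInvariant_volume_prod (N : ℕ) :
    (volume : Measure (Rn N × Rn N)).IsAddRightInvariant := by
  rw [Measure.volume_eq_prod]
  infer_instance

lemma gagliardoEnergy_translate_le {N : ℕ} {s p : ℝ} {Ω Ω' : Set (Rn N)} (hΩ : MeasurableSet Ω)
    (hΩ' : MeasurableSet Ω') (h : Rn N) (hsub : ∀ x ∈ Ω, x + h ∈ Ω') (u : Rn N → ℝ) :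
    gagliardoEnergy s p Ω (fun x => u (x + h)) ≤ gagliardoEnergy s p Ω' u := by
  have := isAddRightInvariant_volume_prod N
  unfold gagliardoEnergy
  rw [← lintegral_indicator (hΩ.prod hΩ), ← lintegral_indicator (hΩ'.prod hΩ'),
    ← lintegral_add_right_eq_self ((Ω' ×ˢ Ω').indicator _) ((h, h) : Rn N × Rn N)]
  refine lintegral_mono fun z => ?_
  by_cases hz : z ∈ Ω ×ˢ Ω
  · rw [indicator_of_mem hz, indicator_of_mem (show z + (h, h) ∈ Ω' ×ˢ Ω' from
      ⟨hsub _ hz.1, hsub _ hz.2⟩)]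
    simp
  · rw [indicator_of_notMem hz]
    exact zero_le

lemma add_mem_ball_of_le {N : ℕ} {r R : ℝ} {x h : Rn N} (hR : r + ‖h‖ ≤ R)
    (hx : x ∈ ball (0 : Rn N) r) : x + h ∈ ball (0 : Rn N) R := by
  rw [mem_ball_zero_iff] at *
  exact (norm_add_le _ _).trans_lt (by linarith)

lemma lintegral_tail_translate_le {N : ℕ} {p m : ℝ} (hm : 0 ≤ m) {u : Rn N → ℝ}
    {h : Rn N} (hh : ‖h‖ ≤ 1) :
    ∫⁻ y, ENNReal.ofReal (|u (y + h)| ^ (p - 1) * weight m y) ≤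
      ENNReal.ofReal (2 ^ m) * ∫⁻ y, ENNReal.ofReal (|u y| ^ (p - 1) * weight m y) := by
  rw [← lintegral_add_right_eq_self (fun y => ENNReal.ofReal (|u y| ^ (p - 1) * weight m y)) h,
    ← lintegral_const_mul' _ _ ENNReal.ofReal_ne_top]
  refine lintegral_mono fun y => ?_
  rw [← ENNReal.ofReal_mul (by positivity)]
  apply ENNReal.ofReal_le_ofReal
  have := mul_le_mul_of_nonneg_left (weight_le_translate (y := y) hm hh)
    (Real.rpow_nonneg (abs_nonneg (u (y + h))) (p - 1))
  linarith

lemma abs_testFn_le {N : ℕ} {b ρ d : ℝ} (hb : 2 ≤ b) (hd : 0 < d) {h : Rn N} {u : Rn N → ℝ}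
    (hu : ∀ x ∈ ball (0 : Rn N) ρ, |u (x + h) - u x| ≤ 2) (x : Rn N) :
    |testFn b ρ d h u x| ≤ 2 ^ (b - 1) := by
  by_cases hx : x ∈ ball (0 : Rn N) ρ
  · rw [testFn, abs_mul, abs_J hb, abs_of_nonneg (sq_nonneg (cutoff ρ d x))]
    have h1 : |u (x + h) - u x| ^ (b - 1) ≤ 2 ^ (b - 1) :=
      Real.rpow_le_rpow (abs_nonneg _) (hu x hx) (by linarith)
    have h2 : cutoff ρ d x ^ 2 ≤ 1 := pow_le_one₀ (cutoff_nonneg _ _ _) (cutoff_le_one _ _ _)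
    calc _ ≤ (2 : ℝ) ^ (b - 1) * 1 := by gcongr
      _ = _ := mul_one _
  · rw [testFn, cutoff_eq_zero hd hx]
    simp only [ne_eq, OfNat.ofNat_ne_zero, not_false_eq_true, zero_pow, mul_zero, abs_zero]
    positivity

lemma testFn_eq_zero {N : ℕ} {b ρ d : ℝ} (hd : 0 < d) {h : Rn N} {u : Rn N → ℝ} {x : Rn N}
    (hx : x ∉ ball (0 : Rn N) ρ) : testFn b ρ d h u x = 0 := by
  simp [testFn, cutoff_eq_zero hd hx]

/-- `J b` is Lipschitz on `[-2, 2]`, so the energy is inherited from `u` and its translate. The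
Lipschitz cutoff contributes the kernel `‖x - y‖^(p(1-s)-N)`, integrable since `s < 1`. -/
lemma gagliardoEnergy_testFn_lt_top {N : ℕ} (hN : 1 ≤ N) {s p b ρ d R : ℝ} (hs1 : s < 1)
    (hp : 2 ≤ p) (hb : 2 ≤ b) (hd : 0 < d) (hR : R ≤ 1) {h : Rn N} {u : Rn N → ℝ}
    (hu : Measurable u) (hw : ∀ x ∈ ball (0 : Rn N) R, |u (x + h) - u x| ≤ 2)
    (hE : gagliardoEnergy s p (ball 0 R) u < ∞)
    (hEh : gagliardoEnergy s p (ball 0 R) (fun x => u (x + h)) < ∞) :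
    gagliardoEnergy s p (ball 0 R) (testFn b ρ d h u) < ∞ := by
  have hp0 : 0 < p := by linarith
  set m := (N : ℝ) + s * p with hm
  set C₁ : ℝ := 2 * (b - 1) * 2 ^ (b - 2) with hC₁
  have hC₁0 : 0 ≤ C₁ := by
    have : 0 ≤ b - 1 := by linarith
    positivity
  set c₁ : ℝ := 2 ^ p * (C₁ ^ p * 2 ^ p) with hc₁
  set c₂ : ℝ := 2 ^ p * (2 ^ b / d) ^ p with hc₂
  have hc₁0 : 0 ≤ c₁ := by positivity
  have hc₂0 : 0 ≤ c₂ := by positivity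
  have hker : ∫⁻ z in ball (0 : Rn N) R ×ˢ ball (0 : Rn N) R,
      1 * ENNReal.ofReal (‖z.1 - z.2‖ ^ (p * (1 - s) - N)) < ∞ := by
    refine (lintegral_prod_self_le_of_slices measurableSet_ball (ball_subset_ball hR)
      measurable_const (M := volume (ball (0 : Rn N) 1)) fun ξ => ?_).trans_lt ?_
    · rw [setLIntegral_const, one_mul]
      exact measure_mono fun x hx => ball_subset_ball hR hx.1
    · exact ENNReal.mul_lt_top measure_ball_lt_top
        (lintegral_norm_rpow_ball_lt_top hN (by nlinarith) _)
  simp only [one_mul] at hker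
  have hpt : ∀ z ∈ ball (0 : Rn N) R ×ˢ ball (0 : Rn N) R,
      ENNReal.ofReal (|testFn b ρ d h u z.1 - testFn b ρ d h u z.2| ^ p / ‖z.1 - z.2‖ ^ m) ≤
      ENNReal.ofReal c₁ * (ENNReal.ofReal (|u (z.1 + h) - u (z.2 + h)| ^ p / ‖z.1 - z.2‖ ^ m) +
        ENNReal.ofReal (|u z.1 - u z.2| ^ p / ‖z.1 - z.2‖ ^ m)) +
      ENNReal.ofReal c₂ * ENNReal.ofReal (‖z.1 - z.2‖ ^ (p * (1 - s) - N)) := by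
    rintro ⟨x, y⟩ ⟨hx, hy⟩
    simp only at hx hy ⊢
    rcases eq_or_ne x y with rfl | hne
    · simp [Real.zero_rpow hp0.ne']
    have hpos : 0 < ‖x - y‖ := norm_pos_iff.mpr (sub_ne_zero.mpr hne)
    rw [← ENNReal.ofReal_add (by positivity) (by positivity), ← ENNReal.ofReal_mul hc₁0,
      ← ENNReal.ofReal_mul hc₂0, ← ENNReal.ofReal_add (by positivity) (by positivity)]
    apply ENNReal.ofReal_le_ofReal
    have k1 := abs_J_cutoff_sub_le hb (hw x hx) (hw y hy) (cutoff_nonneg ρ d x)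
      (cutoff_le_one ρ d x) (cutoff_nonneg ρ d y) (cutoff_le_one ρ d y)
    have k2 : |testFn b ρ d h u x - testFn b ρ d h u y| ≤
        C₁ * |(u (x + h) - u (y + h)) - (u x - u y)| + 2 ^ b / d * ‖x - y‖ := by
      refine k1.trans (add_le_add (le_of_eq ?_) ?_)
      · rw [hC₁]; congr 2; ring
      · rw [div_mul_eq_mul_div, mul_div_assoc]
        gcongr
        exact abs_cutoff_sub_le hd x y
    have k3 : |testFn b ρ d h u x - testFn b ρ d h u y| ^ p ≤
        c₁ * (|u (x + h) - u (y + h)| ^ p + |u x - u y| ^ p) + c₂ * ‖x - y‖ ^ p := by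
      refine (Real.rpow_le_rpow (abs_nonneg _) k2 hp0.le).trans
        ((add_rpow_le_two_rpow (by positivity) (by positivity) hp0.le).trans ?_)
      have i1 : 0 ≤ 2 ^ b / d := by positivity
      rw [Real.mul_rpow hC₁0 (abs_nonneg _), Real.mul_rpow i1 hpos.le, mul_add]
      refine add_le_add ?_ (le_of_eq (by rw [hc₂]; ring))
      calc _ ≤ 2 ^ p * (C₁ ^ p * (2 ^ p * (|u (x + h) - u (y + h)| ^ p + |u x - u y| ^ p))) := by
            have := abs_sub_rpow_le (x := u (x + h) - u (y + h)) (y := u x - u y) hp0.le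
            have i2 : 0 ≤ C₁ ^ p := by positivity
            gcongr
        _ = _ := by rw [hc₁]; ring
    have k4 : ‖x - y‖ ^ (p * (1 - s) - N) = ‖x - y‖ ^ p / ‖x - y‖ ^ m := by
      rw [← Real.rpow_sub hpos]; congr 1; rw [hm]; ring
    rw [k4, ← add_div, mul_div_assoc', mul_div_assoc', ← add_div]
    gcongr
  refine (setLIntegral_mono (by fun_prop) hpt).trans_lt ?_
  rw [lintegral_add_left (by fun_prop), lintegral_const_mul _ (by fun_prop),
    lintegral_const_mul _ (by fun_prop), lintegral_add_left (by fun_prop)]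
  exact ENNReal.add_lt_top.mpr ⟨ENNReal.mul_lt_top ENNReal.ofReal_lt_top
    (ENNReal.add_lt_top.mpr ⟨hEh, hE⟩), ENNReal.mul_lt_top ENNReal.ofReal_lt_top hker⟩

lemma tsupport_subset_closedBall {N : ℕ} {φ : Rn N → ℝ} {r : ℝ}
    (h0 : ∀ x ∉ ball (0 : Rn N) r, φ x = 0) : tsupport φ ⊆ closedBall 0 r := by
  refine closure_minimal (fun x hx => ?_) isClosed_closedBall
  by_contra hn
  exact hx (h0 x fun hb => hn (ball_subset_closedBall hb))

lemma integral_weakIntegrand_eq_zero {N : ℕ} {s p ρ M : ℝ} {T : ℝ≥0∞}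
    (hρ : ρ < 2) {u φ : Rn N → ℝ} (hu : RegularSolution s p T u) (hφ : Measurable φ)
    (hM : ∀ x, |φ x| ≤ M) (h0 : ∀ x ∉ ball (0 : Rn N) ρ, φ x = 0)
    (hφE : gagliardoEnergy s p univ φ < ∞) : ∫ z, weakIntegrand s p u φ z = 0 := by
  have hts := tsupport_subset_closedBall h0
  refine hu.weak_eq φ ⟨?_, (gagliardoEnergy_mono (subset_univ _) φ).trans_lt hφE⟩ ?_ ?_
  · have : IsFiniteMeasure (volume.restrict (ball (0 : Rn N) 2)) :=
      ⟨by simpa using measure_ball_lt_top⟩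
    exact MemLp.of_bound hφ.aestronglyMeasurable M (Eventually.of_forall hM)
  · exact (isCompact_closedBall (0 : Rn N) ρ).of_isClosed_subset (isClosed_tsupport φ) hts
  · exact hts.trans (closedBall_subset_ball hρ)

/-- The discretely differentiated equation. -/
lemma integral_diff_weakIntegrand_eq_zero {N : ℕ} (hN : 1 ≤ N) {s p b d ρ R : ℝ} {T : ℝ≥0∞}
    (hs : 0 < s) (hs1 : s < 1) (hp : 2 ≤ p) (hb : 2 ≤ b) (hT : T < ∞) (hd : 0 < d) (hρR : ρ < R)
    {u : Rn N → ℝ} (hu : RegularSolution s p T u) {h : Rn N} (hh : R + ‖h‖ ≤ 1) (hh1 : ‖h‖ ≤ 1) :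
    Integrable (fun z => weakIntegrand s p (fun x => u (x + h)) (testFn b ρ d h u) z -
      weakIntegrand s p u (testFn b ρ d h u) z) ∧
    ∫ z, (weakIntegrand s p (fun x => u (x + h)) (testFn b ρ d h u) z -
      weakIntegrand s p u (testFn b ρ d h u) z) = 0 := by
  have hum := hu.measurable
  have hsp : 0 < s * p := mul_pos hs (by linarith)
  have hR : R ≤ 1 := by linarith [norm_nonneg h]
  have hbu : ∀ x ∈ ball (0 : Rn N) R, |u x| ≤ 1 := fun x hx => hu.bound x (ball_subset_ball hR hx)
  have hbuh : ∀ x ∈ ball (0 : Rn N) R, |u (x + h)| ≤ 1 := fun x hx =>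
    hu.bound _ (add_mem_ball_of_le hh hx)
  have hw : ∀ x ∈ ball (0 : Rn N) R, |u (x + h) - u x| ≤ 2 := fun x hx =>
    (abs_sub _ _).trans (by linarith [hbu x hx, hbuh x hx])
  have hE : gagliardoEnergy s p (ball 0 R) u < ∞ :=
    (gagliardoEnergy_mono (ball_subset_ball hR) u).trans_lt hu.energy
  have hEh : gagliardoEnergy s p (ball 0 R) (fun x => u (x + h)) < ∞ :=
    (gagliardoEnergy_translate_le measurableSet_ball measurableSet_ball h
      (fun x hx => add_mem_ball_of_le hh hx) u).trans_lt hu.energy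
  set φ := testFn b ρ d h u with hφ
  have hφm : Measurable φ := measurable_testFn hum
  have hM : ∀ x, |φ x| ≤ 2 ^ (b - 1) :=
    abs_testFn_le hb hd fun x hx => hw x (ball_subset_ball hρR.le hx)
  have h0 : ∀ x ∉ ball (0 : Rn N) ρ, φ x = 0 := fun x hx => testFn_eq_zero hd hx
  have hφE : gagliardoEnergy s p (ball 0 R) φ < ∞ :=
    gagliardoEnergy_testFn_lt_top hN hs1 hp hb hd hR hum hw hE hEh
  have hφU := gagliardoEnergy_univ_lt_top hs hp hρR hR hM h0 hφE
  have hTu := hu.tail_le.trans_lt hT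
  have i1 := integrable_weakIntegrand hs hp hρR hR hum hφm hbu hE hTu hM h0 hφE
  have i2 := integrable_weakIntegrand (v := fun x => u (x + h)) hs hp hρR hR (by fun_prop) hφm
    hbuh hEh ((lintegral_tail_translate_le (by positivity) hh1).trans_lt
      (ENNReal.mul_lt_top ENNReal.ofReal_lt_top hTu)) hM h0 hφE
  refine ⟨i2.sub i1, ?_⟩
  rw [integral_sub i2 i1, integral_weakIntegrand_eq_zero (by linarith) hu hφm hM h0 hφU,
    sub_zero]
  have hz : ∀ x ∉ ball (0 : Rn N) 1, φ (x - h) = 0 := by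
    intro x hx
    refine h0 _ fun hxh => hx ?_
    have := add_mem_ball_of_le (h := h) (R := 1) (by linarith) hxh
    rwa [sub_add_cancel] at this
  have hU : gagliardoEnergy s p univ (fun x => φ (x - h)) < ∞ := by
    simp_rw [sub_eq_add_neg]
    exact (gagliardoEnergy_translate_le MeasurableSet.univ MeasurableSet.univ (-h)
      (fun _ _ => mem_univ _) φ).trans_lt hφU
  have := isAddRightInvariant_volume_prod N
  -- Translating both variables by `h` turns the weak form of `u` against `φ(· - h)` into that of
  -- `u(· + h)` against `φ`.
  rw [← integral_weakIntegrand_eq_zero one_lt_two hu (φ := fun x => φ (x - h)) (by fun_prop)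
    (fun x => hM _) hz hU, ← integral_add_right_eq_self
    (weakIntegrand s p u fun x => φ (x - h)) ((h, h) : Rn N × Rn N)]
  simp [weakIntegrand]

/-! ### The Caccioppoli inequality. -/

/-- The positive and negative parts of `H` have equal finite integrals and cancel. In this form
neither `G` nor `F` has to be integrable beforehand. -/
lemma lintegral_le_of_integral_eq_zero {X : Type*} [MeasurableSpace X] {μ : Measure X}
    {H : X → ℝ} (hH : Integrable H μ) (h0 : ∫ z, H z ∂μ = 0) {G F : X → ℝ≥0∞}
    (hF : Measurable F)
    (hle : ∀ z, G z + ENNReal.ofReal (-H z) ≤ ENNReal.ofReal (H z) + F z) :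
    ∫⁻ z, G z ∂μ ≤ ∫⁻ z, F z ∂μ := by
  have hp : ∫⁻ z, ENNReal.ofReal (H z) ∂μ ≠ ∞ := hH.lintegral_lt_top.ne
  have hn : ∫⁻ z, ENNReal.ofReal (-H z) ∂μ ≠ ∞ := hH.neg.lintegral_lt_top.ne
  rw [integral_eq_lintegral_pos_part_sub_lintegral_neg_part hH, sub_eq_zero,
    ENNReal.toReal_eq_toReal_iff' hp hn] at h0
  have h1 := lintegral_mono (μ := μ) hle
  have hm : AEMeasurable (fun z => ENNReal.ofReal (-H z)) μ :=
    hH.aestronglyMeasurable.aemeasurable.neg.ennreal_ofReal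
  rw [lintegral_add_right' _ hm,
    lintegral_add_right _ hF, h0, add_comm] at h1
  exact (ENNReal.add_le_add_iff_left hn).mp h1

lemma abs_J_sub_le_far {p A B A' B' : ℝ} (hp : 2 ≤ p) (hA : |A| ≤ 1) (hB : |B| ≤ 1) :
    |J p (A - A') - J p (B - B')| ≤ 2 ^ p * (1 + |A'| ^ (p - 1) + |B'| ^ (p - 1)) := by
  have hp1 : 0 ≤ p - 1 := by linarith
  have h1 : |A - A'| ^ (p - 1) ≤ 2 ^ (p - 1) * (1 + |A'| ^ (p - 1)) := by
    refine (abs_sub_rpow_le hp1).trans ?_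
    gcongr
    exact Real.rpow_le_one (abs_nonneg _) hA hp1
  have h2 : |B - B'| ^ (p - 1) ≤ 2 ^ (p - 1) * (1 + |B'| ^ (p - 1)) := by
    refine (abs_sub_rpow_le hp1).trans ?_
    gcongr
    exact Real.rpow_le_one (abs_nonneg _) hB hp1
  have h3 : (2 : ℝ) ^ p = 2 ^ (p - 1) * 2 := by
    rw [← Real.rpow_add_one (by norm_num)]; congr 1; ring
  have h4 := abs_sub (J p (A - A')) (J p (B - B'))
  rw [abs_J hp, abs_J hp] at h4
  rw [h3]
  have h5 : 0 ≤ (2 : ℝ) ^ (p - 1) * |A'| ^ (p - 1) := by positivity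
  have h6 : 0 ≤ (2 : ℝ) ^ (p - 1) * |B'| ^ (p - 1) := by positivity
  nlinarith

/-- Caccioppoli-type inequality for the first order difference `δ_h u`. -/
lemma lintegral_diff_energy_le {N : ℕ} (hN : 1 ≤ N) {s p b d ρ R a : ℝ} {T : ℝ≥0∞}
    (hs : 0 < s) (hs1 : s < 1) (hp : 2 ≤ p) (hb : 2 ≤ b) (hT : T < ∞) (ha : 0 < a) (had : a ≤ d)
    (hρR : a ≤ R - ρ) {u : Rn N → ℝ} (hu : RegularSolution s p T u) {h : Rn N}
    (hh : R + ‖h‖ ≤ 1) (hh1 : ‖h‖ ≤ 1) :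
    ∫⁻ z in ball (0 : Rn N) (ρ - d) ×ˢ ball (0 : Rn N) (ρ - d),
      ENNReal.ofReal (|(u (z.1 + h) - u z.1) - (u (z.2 + h) - u z.2)| ^ (p + b - 2) /
        ‖z.1 - z.2‖ ^ ((N : ℝ) + s * p)) ≤
    ENNReal.ofReal (2 ^ (p + b - 2)) *
      ((∫⁻ z in ball (0 : Rn N) R ×ˢ ball (0 : Rn N) R, ENNReal.ofReal
        ((p - 1) * (|u (z.1 + h) - u (z.2 + h)| ^ (p - 2) + |u z.1 - u z.2| ^ (p - 2)) *
        ((|u (z.1 + h) - u z.1| ^ b + |u (z.2 + h) - u z.2| ^ b) *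
          (cutoff ρ d z.1 - cutoff ρ d z.2) ^ 2) / ‖z.1 - z.2‖ ^ ((N : ℝ) + s * p))) +
      2 * ((∫⁻ x in ball (0 : Rn N) ρ, ENNReal.ofReal (|u (x + h) - u x| ^ (b - 1))) *
        (ENNReal.ofReal (2 ^ p * (1 + 2 / a) ^ ((N : ℝ) + s * p)) *
        ((∫⁻ y : Rn N, ENNReal.ofReal (weight ((N : ℝ) + s * p) y)) +
          ENNReal.ofReal (2 ^ ((N : ℝ) + s * p)) * T + T)))) := by
  have hum := hu.measurable
  have hd : 0 < d := by linarith
  have hsp : 0 < s * p := mul_pos hs (by linarith)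
  set m : ℝ := (N : ℝ) + s * p with hm
  have hm0 : 0 ≤ m := by positivity
  have hR : R ≤ 1 := by linarith [norm_nonneg h]
  set E := ball (0 : Rn N) R with hE
  set A := ball (0 : Rn N) ρ with hA
  set E' := ball (0 : Rn N) (ρ - d) with hE'
  have hAE : A ⊆ E := ball_subset_ball (by linarith)
  have hE'A : E' ⊆ A := ball_subset_ball (by linarith)
  set c : ℝ := 2 ^ p * (1 + 2 / a) ^ m with hc
  set av : Rn N → ℝ≥0∞ := fun x => ENNReal.ofReal (|u (x + h) - u x| ^ (b - 1)) with hav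
  set bv : Rn N → ℝ≥0∞ := fun y => ENNReal.ofReal c * (ENNReal.ofReal (weight m y) +
    ENNReal.ofReal (|u (y + h)| ^ (p - 1) * weight m y) +
    ENNReal.ofReal (|u y| ^ (p - 1) * weight m y)) with hbv
  have havm : Measurable av := by fun_prop
  have hbvm : Measurable bv := by fun_prop
  have hbI : ∫⁻ y, bv y ≤ ENNReal.ofReal c * ((∫⁻ y : Rn N, ENNReal.ofReal (weight m y)) +
          ENNReal.ofReal (2 ^ m) * T + T) := by
    rw [hbv, lintegral_const_mul _ (by fun_prop), lintegral_add_left (by fun_prop),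
      lintegral_add_left (by fun_prop)]
    gcongr
    · refine (lintegral_tail_translate_le hm0 hh1).trans ?_
      gcongr
      exact hu.tail_le
    · exact hu.tail_le
  set bad : Rn N × Rn N → ℝ := fun z =>
    (p - 1) * (|u (z.1 + h) - u (z.2 + h)| ^ (p - 2) + |u z.1 - u z.2| ^ (p - 2)) *
        ((|u (z.1 + h) - u z.1| ^ b + |u (z.2 + h) - u z.2| ^ b) *
          (cutoff ρ d z.1 - cutoff ρ d z.2) ^ 2) / ‖z.1 - z.2‖ ^ m with hbad
  have hbadm : Measurable bad := by fun_prop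
  obtain ⟨hHi, hH0⟩ := integral_diff_weakIntegrand_eq_zero hN hs hs1 hp hb hT hd
    (by linarith : ρ < R) hu hh hh1
  set H : Rn N × Rn N → ℝ := fun z =>
    weakIntegrand s p (fun x => u (x + h)) (testFn b ρ d h u) z -
      weakIntegrand s p u (testFn b ρ d h u) z with hH
  have hHeq : ∀ x y, H (x, y) =
      (J p (u (x + h) - u (y + h)) - J p (u x - u y)) *
        (J b (u (x + h) - u x) * cutoff ρ d x ^ 2 - J b (u (y + h) - u y) * cutoff ρ d y ^ 2) /
        ‖x - y‖ ^ m := by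
    intro x y
    simp only [hH, weakIntegrand, testFn]
    ring
  have hHsymm : ∀ x y, H (x, y) = H (y, x) := by
    intro x y
    rw [hHeq, hHeq, norm_sub_rev, ← neg_sub (u (x + h)), ← neg_sub (u x) (u y), J_neg, J_neg]
    ring
  -- The good term is kept only where both cutoffs equal `1`. On the rest of `E ×ˢ E` a lower bound
  -- by the negative of the local error is enough.
  set G : Rn N × Rn N → ℝ≥0∞ := (E' ×ˢ E').indicator fun z =>
    ENNReal.ofReal ((2 ^ (p + b - 2))⁻¹) *
    ENNReal.ofReal (|(u (z.1 + h) - u z.1) - (u (z.2 + h) - u z.2)| ^ (p + b - 2) /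
        ‖z.1 - z.2‖ ^ m) with hG
  have hpt : ∀ z, G z + ENNReal.ofReal (-H z) ≤ ENNReal.ofReal (H z) +
      ((E ×ˢ E).indicator (fun z => ENNReal.ofReal (bad z)) z + offDiag A av bv z) := by
    rintro ⟨x, y⟩
    have hnn : 0 ≤ ‖x - y‖ ^ m := by positivity
    by_cases hz' : (x, y) ∈ E' ×ˢ E'
    · have hHG : (2 ^ (p + b - 2))⁻¹ * (|(u (x + h) - u x) - (u (y + h) - u y)| ^ (p + b - 2) /
        ‖x - y‖ ^ m) ≤ H (x, y) := by
        rw [hHeq, cutoff_eq_one hd hz'.1, cutoff_eq_one hd hz'.2, one_pow, mul_one, mul_one,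
          ← mul_div_assoc]
        refine div_le_div_of_nonneg_right ?_ hnn
        rw [inv_mul_le_iff₀ (by positivity)]
        exact abs_sub_rpow_le_J_sub_mul_J_sub hp hb (by ring)
      rw [hG, indicator_of_mem hz', ← ENNReal.ofReal_mul (by positivity),
        ENNReal.ofReal_of_nonpos (neg_nonpos.mpr (le_trans (by positivity) hHG)), add_zero]
      exact (ENNReal.ofReal_le_ofReal hHG).trans le_self_add
    · rw [hG, indicator_of_notMem hz', zero_add]
      by_cases hz : (x, y) ∈ E ×ˢ E
      · have hHb : -H (x, y) ≤ bad (x, y) := by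
          rw [hHeq, hbad, ← neg_div]
          refine div_le_div_of_nonneg_right ?_ hnn
          rw [neg_le]
          exact neg_le_J_sub_mul_cutoff hp hb (by ring)
        rw [indicator_of_mem hz]
        exact (ENNReal.ofReal_le_ofReal hHb).trans (le_self_add.trans le_add_self)
      · refine le_trans ?_ (le_add_self.trans le_add_self)
        refine le_offDiag (F := fun z => ENNReal.ofReal (-H z)) hAE ?_ ?_ ?_ hz
        · intro x y
          rw [hHsymm]
        · intro x y hx hy
          rw [hHeq, cutoff_eq_zero hd hx, cutoff_eq_zero hd hy]
          simp
        · intro x y hx hy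
          have hyA : y ∉ A := fun hyA => hy (hAE hyA)
          have hw := weight_nonneg m y
          rw [hav, hbv]
          simp only
          rw [← ENNReal.ofReal_add hw (by positivity), ← ENNReal.ofReal_add (by positivity)
            (by positivity), ← ENNReal.ofReal_mul (by positivity),
            ← ENNReal.ofReal_mul (by positivity)]
          apply ENNReal.ofReal_le_ofReal
          refine (neg_le_abs _).trans ?_
          rw [hHeq, cutoff_eq_zero hd hyA, abs_div, abs_of_nonneg (by positivity : 0 ≤ ‖x - y‖ ^ m),
            div_eq_mul_inv, abs_mul]
          have k1 := abs_J_sub_le_far (A' := u (y + h)) (B' := u y) hp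
            (hu.bound _ (add_mem_ball_of_le hh (hAE hx))) (hu.bound _ (ball_subset_ball hR (hAE hx)))
          have k2 : |J b (u (x + h) - u x) * cutoff ρ d x ^ 2 - J b (u (y + h) - u y) * 0 ^ 2| ≤
              |u (x + h) - u x| ^ (b - 1) := by
            rw [zero_pow two_ne_zero, mul_zero, sub_zero, abs_mul, abs_J hb,
              abs_of_nonneg (sq_nonneg (cutoff ρ d x))]
            exact mul_le_of_le_one_right (by positivity)
              (pow_le_one₀ (cutoff_nonneg _ _ _) (cutoff_le_one _ _ _))
          have hx1 : ‖x‖ < 1 := by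
            have := ball_subset_ball hR (hAE hx)
            rwa [mem_ball_zero_iff] at this
          have k3 := inv_rpow_le_weight hm0 ha hx1 (hρR.trans (sub_le_norm_sub hx hy))
          calc _ ≤ (2 ^ p * (1 + |u (y + h)| ^ (p - 1) + |u y| ^ (p - 1))) *
                |u (x + h) - u x| ^ (b - 1) * ((1 + 2 / a) ^ m * weight m y) := by gcongr
            _ = _ := by rw [hc]; ring
  have hEE : MeasurableSet (E ×ˢ E) := measurableSet_ball.prod measurableSet_ball
  have hoff : Measurable (offDiag A av bv) := measurable_offDiag measurableSet_ball havm hbvm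
  have key := lintegral_le_of_integral_eq_zero hHi hH0
    ((hbadm.ennreal_ofReal.indicator hEE).add hoff) hpt
  rw [hG, lintegral_indicator (measurableSet_ball.prod measurableSet_ball)] at key
  rw [lintegral_const_mul _ (by fun_prop)] at key
  simp only [Pi.add_apply] at key
  rw [lintegral_add_right _ hoff, lintegral_indicator hEE,
    lintegral_offDiag measurableSet_ball havm hbvm] at key
  have hcinv : ENNReal.ofReal (2 ^ (p + b - 2)) * ENNReal.ofReal ((2 ^ (p + b - 2))⁻¹) = 1 := by
    rw [← ENNReal.ofReal_mul (by positivity), mul_inv_cancel₀ (by positivity), ENNReal.ofReal_one]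
  calc _ = ENNReal.ofReal (2 ^ (p + b - 2)) * (ENNReal.ofReal ((2 ^ (p + b - 2))⁻¹) *
        ∫⁻ z in E' ×ˢ E', ENNReal.ofReal (|(u (z.1 + h) - u z.1) - (u (z.2 + h) - u z.2)| ^
          (p + b - 2) / ‖z.1 - z.2‖ ^ m)) := by
        rw [← mul_assoc, hcinv, one_mul]
    _ ≤ _ := by
        refine mul_le_mul_right (key.trans ?_) _
        gcongr

/-! ### The local error. -/

/-- Slices require every `ξ`: short ones are handled by doubling, while for `‖ξ‖ ≥ h₀` the bound
`|v| ≤ 1` suffices. -/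
lemma lintegral_pair_diff_le (N : ℕ) {s q a : ℝ} (hs0 : 0 < s) (hs1 : s < 1)
    (hq : 1 ≤ q) (ha : 0 < a) :
    ∃ K : ℝ≥0∞, K < ∞ ∧ ∀ h₀, a ≤ h₀ → ∀ v : Rn N → ℝ, Measurable v →
      (∀ x ∈ ball (0 : Rn N) 1, |v x| ≤ 1) → ∀ ρ, ρ + h₀ ≤ 1 → ∀ S : ℝ≥0∞, S < ∞ →
      (∀ h : Rn N, 0 < ‖h‖ → ‖h‖ < h₀ → ∫⁻ x in ball (0 : Rn N) ρ,
        ENNReal.ofReal (|secondDiff h v x| ^ q / ‖h‖ ^ (s * q)) ≤ S) →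
      ∀ ξ : Rn N, ∫⁻ x in {x | x ∈ ball (0 : Rn N) ρ ∧ x + ξ ∈ ball (0 : Rn N) ρ},
        ENNReal.ofReal (|v x - v (x + ξ)| ^ q / ‖ξ‖ ^ (s * q)) ≤ K * (S + 1) := by
  obtain ⟨K, hK, hKd⟩ := lintegral_diff_le_of_secondDiff N hs0 hs1 hq ha
  set K' : ℝ≥0∞ := ENNReal.ofReal (2 ^ q / a ^ (s * q)) * volume (ball (0 : Rn N) 1) with hK'
  refine ⟨K + K', ENNReal.add_lt_top.mpr
    ⟨hK, ENNReal.mul_lt_top ENNReal.ofReal_lt_top measure_ball_lt_top⟩, ?_⟩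
  intro h₀ hah v hv hvb ρ hρ S hS hSd ξ
  rcases (norm_nonneg ξ).eq_or_lt with h0 | hpos
  · rw [eq_comm, norm_eq_zero] at h0
    subst h0
    simp [Real.zero_rpow (by linarith : q ≠ 0)]
  rcases lt_or_ge ‖ξ‖ h₀ with hlt | hge
  · have hsub : {x | x ∈ ball (0 : Rn N) ρ ∧ x + ξ ∈ ball (0 : Rn N) ρ} ⊆ ball 0 ρ :=
      fun x hx => hx.1
    refine (lintegral_mono_set hsub).trans ?_
    simp_rw [abs_sub_comm (v _) (v (_ + ξ))]
    refine (hKd h₀ hah v hv hvb ρ hρ S hS hSd ξ hpos hlt).trans ?_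
    gcongr
    exact le_self_add
  · calc _ ≤ ∫⁻ x in {x | x ∈ ball (0 : Rn N) ρ ∧ x + ξ ∈ ball (0 : Rn N) ρ},
          ENNReal.ofReal (2 ^ q / a ^ (s * q)) := by
          refine setLIntegral_mono (by fun_prop) fun x hx => ?_
          have h1 := hvb x (ball_subset_ball (by linarith) hx.1)
          have h2 := hvb (x + ξ) (ball_subset_ball (by linarith) hx.2)
          apply ENNReal.ofReal_le_ofReal
          gcongr
          · exact (abs_sub _ _).trans (by linarith)
          · linarith
      _ ≤ K' := by
          rw [setLIntegral_const, hK']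
          gcongr
          exact fun x hx => ball_subset_ball (by linarith) hx.1
      _ ≤ (K + K') * (S + 1) := by
          calc K' = K' * 1 := (mul_one _).symm
            _ ≤ _ := by gcongr <;> exact le_add_self

/-- The bound `|A| ≤ 2` absorbs two powers of `|A|` into the factor `4`. The remaining exponents add
up to `q - 1`, hence the product of normalised quotients is controlled by their `q`-th powers. -/
lemma rpow_mul_rpow_le_scaled {s p q b σ A t l : ℝ} (hp : 2 ≤ p) (hb : 2 ≤ b)
    (hq : p + b = q + 3) (ht : 0 < t) (hl : 0 < l) (hA : |A| ≤ 2) :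
    |σ| ^ (p - 2) * |A| ^ b ≤ 4 * l ^ (s * (b - 2)) * t ^ (s * (p - 2)) *
      (1 + |σ| ^ q / t ^ (s * q) + |A| ^ q / l ^ (s * q)) := by
  have h1 : |A| ^ b ≤ 4 * |A| ^ (b - 2) := by
    have := abs_rpow_mul_sq (t := A) (r := b - 2) (by linarith)
    rw [sub_add_cancel] at this
    rw [← this, mul_comm]
    gcongr
    rw [← sq_abs]
    nlinarith [abs_nonneg A]
  have h2 := rpow_mul_rpow_le (x := |σ| / t ^ s) (y := |A| / l ^ s) (a := p - 2) (b := b - 2)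
    (c := q) (by positivity) (by positivity) (by linarith) (by linarith) (by linarith)
  have e : ∀ x r y : ℝ, 0 < y → (|x| / y ^ s) ^ r = |x| ^ r / y ^ (s * r) := by
    intro x r y hy
    rw [Real.div_rpow (abs_nonneg _) (by positivity), ← Real.rpow_mul hy.le]
  rw [e _ _ _ ht, e _ _ _ hl, e _ _ _ ht, e _ _ _ hl] at h2
  calc |σ| ^ (p - 2) * |A| ^ b ≤ |σ| ^ (p - 2) * (4 * |A| ^ (b - 2)) := by gcongr
    _ = 4 * l ^ (s * (b - 2)) * t ^ (s * (p - 2)) *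
        (|σ| ^ (p - 2) / t ^ (s * (p - 2)) * (|A| ^ (b - 2) / l ^ (s * (b - 2)))) := by
        field_simp
    _ ≤ _ := by gcongr

/-- The Lipschitz cutoff gains `t²` and the normalised differences `t^(s(p-2))`. Against `t^(-n-sp)`
this leaves exponent `2 - 2s - n`. -/
lemma local_error_le {s p q b σ τ A B ζ t l d : ℝ} {n : ℝ} (hp : 2 ≤ p) (hb : 2 ≤ b)
    (hq : p + b = q + 3) (ht : 0 < t) (hl : 0 < l) (hA : |A| ≤ 2) (hB : |B| ≤ 2)
    (hζ : |ζ| ≤ t / d) :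
    (p - 1) * (|σ| ^ (p - 2) + |τ| ^ (p - 2)) * ((|A| ^ b + |B| ^ b) * ζ ^ 2) / t ^ (n + s * p) ≤
      (p - 1) * 16 / d ^ 2 * l ^ (s * (b - 2)) *
      ((1 + |σ| ^ q / t ^ (s * q) + |τ| ^ q / t ^ (s * q) + |A| ^ q / l ^ (s * q) +
        |B| ^ q / l ^ (s * q)) * t ^ ((2 - 2 * s) - n)) := by
  have h1 := rpow_mul_rpow_le_scaled (s := s) (σ := σ) hp hb hq ht hl hA
  have h2 := rpow_mul_rpow_le_scaled (s := s) (σ := σ) hp hb hq ht hl hB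
  have h3 := rpow_mul_rpow_le_scaled (s := s) (σ := τ) hp hb hq ht hl hA
  have h4 := rpow_mul_rpow_le_scaled (s := s) (σ := τ) hp hb hq ht hl hB
  have e : t ^ ((2 - 2 * s) - n) = t ^ (s * (p - 2)) * t ^ 2 / t ^ (n + s * p) := by
    rw [← Real.rpow_natCast, ← Real.rpow_add ht, ← Real.rpow_sub ht]
    congr 1
    push_cast
    ring
  have hζ2 : ζ ^ 2 ≤ t ^ 2 / d ^ 2 := by
    rw [← div_pow]
    exact sq_le_sq' (by linarith [neg_abs_le ζ]) ((le_abs_self _).trans hζ)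
  set Q := 1 + |σ| ^ q / t ^ (s * q) + |τ| ^ q / t ^ (s * q) + |A| ^ q / l ^ (s * q) +
        |B| ^ q / l ^ (s * q) with hQ
  set c := 4 * l ^ (s * (b - 2)) * t ^ (s * (p - 2)) with hc
  have hc0 : 0 ≤ c := by positivity
  have i1 : 0 ≤ |σ| ^ q / t ^ (s * q) := by positivity
  have i2 : 0 ≤ |τ| ^ q / t ^ (s * q) := by positivity
  have i3 : 0 ≤ |A| ^ q / l ^ (s * q) := by positivity
  have i4 : 0 ≤ |B| ^ q / l ^ (s * q) := by positivity
  have hQ0 : 0 ≤ Q := by positivity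
  have hsum : (|σ| ^ (p - 2) + |τ| ^ (p - 2)) * (|A| ^ b + |B| ^ b) ≤ 4 * (c * Q) := by
    have j1 := h1.trans (mul_le_mul_of_nonneg_left (by linarith : _ ≤ Q) hc0)
    have j2 := h2.trans (mul_le_mul_of_nonneg_left (by linarith : _ ≤ Q) hc0)
    have j3 := h3.trans (mul_le_mul_of_nonneg_left (by linarith : _ ≤ Q) hc0)
    have j4 := h4.trans (mul_le_mul_of_nonneg_left (by linarith : _ ≤ Q) hc0)
    linarith
  have hp1 : 0 ≤ p - 1 := by linarith
  calc _ = (p - 1) * (((|σ| ^ (p - 2) + |τ| ^ (p - 2)) * (|A| ^ b + |B| ^ b)) * ζ ^ 2) /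
        t ^ (n + s * p) := by ring
    _ ≤ (p - 1) * ((4 * (c * Q)) * (t ^ 2 / d ^ 2)) / t ^ (n + s * p) := by gcongr
    _ = _ := by rw [e, hc]; ring

lemma setLIntegral_translate_le {N : ℕ} {A B : Set (Rn N)} (hA : MeasurableSet A)
    (hB : MeasurableSet B) (h : Rn N) (hAB : ∀ x ∈ A, x + h ∈ B) (f : Rn N → ℝ≥0∞) :
    ∫⁻ x in A, f (x + h) ≤ ∫⁻ x in B, f x := by
  rw [← lintegral_indicator hA, ← lintegral_indicator hB,
    ← lintegral_add_right_eq_self (B.indicator f) h]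
  refine lintegral_mono fun x => ?_
  by_cases hx : x ∈ A
  · rw [indicator_of_mem hx, indicator_of_mem (hAB x hx)]
  · rw [indicator_of_notMem hx]
    exact zero_le

lemma measurableSet_mem_and_add_mem {N : ℕ} {E : Set (Rn N)} (hE : MeasurableSet E) (ξ : Rn N) :
    MeasurableSet {x | x ∈ E ∧ x + ξ ∈ E} :=
  hE.inter ((measurable_add_const ξ) hE)

/-- The local error in the Caccioppoli inequality. -/
lemma lintegral_local_error_le {N : ℕ} (hN : 1 ≤ N) {s p q a : ℝ} (hs0 : 0 < s) (hs1 : s < 1)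
    (hp : 2 ≤ p) (hq : p ≤ q) (ha : 0 < a) :
    ∃ K : ℝ≥0∞, K < ∞ ∧ ∀ h₀, a ≤ h₀ → ∀ u : Rn N → ℝ, Measurable u →
      (∀ x ∈ ball (0 : Rn N) 1, |u x| ≤ 1) → ∀ R, R + 2 * h₀ ≤ 1 → ∀ ρ, ∀ S : ℝ≥0∞, S < ∞ →
      (∀ h : Rn N, 0 < ‖h‖ → ‖h‖ < h₀ → ∫⁻ x in ball (0 : Rn N) (R + h₀),
        ENNReal.ofReal (|secondDiff h u x| ^ q / ‖h‖ ^ (s * q)) ≤ S) →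
      ∀ h : Rn N, 0 < ‖h‖ → ‖h‖ < h₀ →
      ∫⁻ z in ball (0 : Rn N) R ×ˢ ball (0 : Rn N) R, ENNReal.ofReal
        ((p - 1) * (|u (z.1 + h) - u (z.2 + h)| ^ (p - 2) + |u z.1 - u z.2| ^ (p - 2)) *
        ((|u (z.1 + h) - u z.1| ^ (q + 3 - p) + |u (z.2 + h) - u z.2| ^ (q + 3 - p)) *
          (cutoff ρ h₀ z.1 - cutoff ρ h₀ z.2) ^ 2) / ‖z.1 - z.2‖ ^ ((N : ℝ) + s * p)) ≤
      K * ENNReal.ofReal (‖h‖ ^ (s * (q + 1 - p))) * (S + 1) := by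
  obtain ⟨K₁, hK₁, hd₁⟩ := lintegral_diff_le_of_secondDiff N hs0 hs1 (by linarith : 1 ≤ q) ha
  obtain ⟨K₂, hK₂, hd₂⟩ := lintegral_pair_diff_le N hs0 hs1 (by linarith : 1 ≤ q) ha
  set κ : ℝ≥0∞ := ∫⁻ ξ in ball (0 : Rn N) 2, ENNReal.ofReal (‖ξ‖ ^ ((2 - 2 * s) - N)) with hκ
  have hκt : κ < ∞ := lintegral_norm_rpow_ball_lt_top hN (by linarith) _
  set V := volume (ball (0 : Rn N) 1) with hV
  have hVt : V < ∞ := measure_ball_lt_top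
  have hp1 : 0 ≤ p - 1 := by linarith
  refine ⟨ENNReal.ofReal ((p - 1) * 16 / a ^ 2) * ((V + K₂ + K₂ + K₁ + K₁) * κ),
    ENNReal.mul_lt_top ENNReal.ofReal_lt_top (ENNReal.mul_lt_top (by
      simp only [ENNReal.add_lt_top]; tauto) hκt), ?_⟩
  intro h₀ hah u hu hub R hR ρ S hS hSd h hh0 hh
  have hh₀ : 0 < h₀ := by linarith
  set E := ball (0 : Rn N) R with hE
  have hEm : MeasurableSet E := measurableSet_ball
  have hE1 : E ⊆ ball 0 1 := ball_subset_ball (by linarith)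
  have hEh : ∀ x ∈ E, x + h ∈ ball (0 : Rn N) (R + h₀) := fun x hx =>
    add_mem_ball_of_le (by linarith) hx
  have hEE : E ⊆ ball (0 : Rn N) (R + h₀) := ball_subset_ball (by linarith)
  set Dq : Rn N → ℝ≥0∞ := fun x => ENNReal.ofReal (|u (x + h) - u x| ^ q / ‖h‖ ^ (s * q)) with hDq
  have hDm : Measurable Dq := by fun_prop
  have hDE : ∫⁻ x in E, Dq x ≤ K₁ * (S + 1) :=
    (lintegral_mono_set hEE).trans (hd₁ h₀ hah u hu hub (R + h₀) (by linarith) S hS hSd h hh0 hh)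
  set Q : Rn N × Rn N → ℝ≥0∞ := fun z => 1 +
    ENNReal.ofReal (|u (z.1 + h) - u (z.2 + h)| ^ q / ‖z.1 - z.2‖ ^ (s * q)) +
    ENNReal.ofReal (|u z.1 - u z.2| ^ q / ‖z.1 - z.2‖ ^ (s * q)) + Dq z.1 + Dq z.2 with hQ
  have hQm : Measurable Q := by fun_prop
  -- The pair terms are translates of `u` by `ξ`, based at `x + h` or `x`; the `Dq` terms are first
  -- differences in the fixed direction `h`. Enlarging the radius by `h₀` accommodates the shift.
  have hslice : ∀ ξ, ∫⁻ x in {x | x ∈ E ∧ x + ξ ∈ E}, Q (x, x + ξ) ≤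
      (V + K₂ + K₂ + K₁ + K₁) * (S + 1) := by
    intro ξ
    have hSm := measurableSet_mem_and_add_mem hEm ξ
    have hBm := measurableSet_mem_and_add_mem
      (measurableSet_ball : MeasurableSet (ball (0 : Rn N) (R + h₀))) ξ
    have hpair := hd₂ h₀ hah u hu hub (R + h₀) (by linarith) S hS hSd ξ
    simp only [hQ, sub_add_cancel_left, norm_neg]
    rw [lintegral_add_left (by fun_prop), lintegral_add_left (by fun_prop),
      lintegral_add_left (by fun_prop), lintegral_add_left (by fun_prop)]
    simp only [add_mul]
    refine add_le_add (add_le_add (add_le_add (add_le_add ?_ ?_) ?_) ?_) ?_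
    · rw [setLIntegral_const, one_mul]
      have hsub : {x | x ∈ E ∧ x + ξ ∈ E} ⊆ ball 0 1 := fun x hx => hE1 hx.1
      exact (measure_mono hsub).trans (le_mul_of_one_le_right' le_add_self)
    · refine le_trans ?_ hpair
      refine le_trans (le_of_eq ?_) (setLIntegral_translate_le hSm hBm h
        (fun x hx => ⟨hEh x hx.1, by
          have := hEh _ hx.2
          rwa [add_right_comm] at this⟩) _)
      refine lintegral_congr fun x => ?_
      rw [add_right_comm x h ξ]
    · refine le_trans (lintegral_mono_set fun x hx => ?_) hpair
      exact ⟨hEE hx.1, hEE hx.2⟩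
    · exact (lintegral_mono_set fun x hx => hx.1).trans hDE
    · exact (setLIntegral_translate_le hSm hEm ξ (fun x hx => hx.2) Dq).trans hDE
  have hpt : ∀ z ∈ E ×ˢ E, ENNReal.ofReal
        ((p - 1) * (|u (z.1 + h) - u (z.2 + h)| ^ (p - 2) + |u z.1 - u z.2| ^ (p - 2)) *
        ((|u (z.1 + h) - u z.1| ^ (q + 3 - p) + |u (z.2 + h) - u z.2| ^ (q + 3 - p)) *
          (cutoff ρ h₀ z.1 - cutoff ρ h₀ z.2) ^ 2) / ‖z.1 - z.2‖ ^ ((N : ℝ) + s * p)) ≤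
      ENNReal.ofReal ((p - 1) * 16 / a ^ 2) * ENNReal.ofReal (‖h‖ ^ (s * (q + 1 - p))) *
        (Q z * ENNReal.ofReal (‖z.1 - z.2‖ ^ ((2 - 2 * s) - N))) := by
    rintro ⟨x, y⟩ ⟨hx, hy⟩
    simp only at hx hy ⊢
    rcases eq_or_ne x y with rfl | hne
    · simp
    have hpos : 0 < ‖x - y‖ := norm_pos_iff.mpr (sub_ne_zero.mpr hne)
    have hw : ∀ x ∈ E, |u (x + h) - u x| ≤ 2 := fun x hx => (abs_sub _ _).trans (by
      linarith [hub x (hE1 hx), hub _ (ball_subset_ball (by linarith) (hEh x hx))])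
    have k := local_error_le (n := N) (s := s) (σ := u (x + h) - u (y + h)) (τ := u x - u y) hp
      (by linarith : 2 ≤ q + 3 - p) (by ring : p + (q + 3 - p) = q + 3) hpos hh0
      (hw x hx) (hw y hy) (abs_cutoff_sub_le (ρ := ρ) hh₀ x y)
    simp only [hQ, hDq]
    rw [← ENNReal.ofReal_one, ← ENNReal.ofReal_add (by positivity) (by positivity),
      ← ENNReal.ofReal_add (by positivity) (by positivity),
      ← ENNReal.ofReal_add (by positivity) (by positivity),
      ← ENNReal.ofReal_add (by positivity) (by positivity), ← ENNReal.ofReal_mul (by positivity),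
      ← ENNReal.ofReal_mul (by positivity), ← ENNReal.ofReal_mul (by positivity)]
    apply ENNReal.ofReal_le_ofReal
    refine k.trans ?_
    rw [show q + 3 - p - 2 = q + 1 - p by ring]
    gcongr
  calc _ ≤ ∫⁻ z in E ×ˢ E, ENNReal.ofReal ((p - 1) * 16 / a ^ 2) *
        ENNReal.ofReal (‖h‖ ^ (s * (q + 1 - p))) *
        (Q z * ENNReal.ofReal (‖z.1 - z.2‖ ^ ((2 - 2 * s) - N))) :=
        setLIntegral_mono (by fun_prop) hpt
    _ = ENNReal.ofReal ((p - 1) * 16 / a ^ 2) * ENNReal.ofReal (‖h‖ ^ (s * (q + 1 - p))) *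
        ∫⁻ z in E ×ˢ E, Q z * ENNReal.ofReal (‖z.1 - z.2‖ ^ ((2 - 2 * s) - N)) :=
        lintegral_const_mul _ (by fun_prop)
    _ ≤ ENNReal.ofReal ((p - 1) * 16 / a ^ 2) * ENNReal.ofReal (‖h‖ ^ (s * (q + 1 - p))) *
        ((V + K₂ + K₂ + K₁ + K₁) * (S + 1) * κ) := by
        gcongr
        exact lintegral_prod_self_le_of_slices hEm hE1 hQm hslice
    _ = _ := by ring

/-! ### The gain of integrability. -/

lemma two_mul_ofReal (x : ℝ) : 2 * ENNReal.ofReal x = ENNReal.ofReal (2 * x) := by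
  rw [ENNReal.ofReal_mul zero_le_two, ENNReal.ofReal_ofNat]

/-- The integrability gain for regular solutions. -/
lemma lintegral_secondDiff_succ_le {N : ℕ} (hN : 1 ≤ N) {s p q a : ℝ} {T : ℝ≥0∞} (hs0 : 0 < s)
    (hs1 : s < 1) (hp : 2 ≤ p) (hq : p ≤ q) (hT : T < ∞) (ha : 0 < a) :
    ∃ K : ℝ≥0∞, K < ∞ ∧ ∀ h₀, a ≤ h₀ → ∀ u : Rn N → ℝ, RegularSolution s p T u →
      ∀ R, R ≤ 1 - 5 * h₀ → ∀ S : ℝ≥0∞, S < ∞ →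
      (∀ h : Rn N, 0 < ‖h‖ → ‖h‖ < h₀ → ∫⁻ x in ball (0 : Rn N) (R + 4 * h₀),
        ENNReal.ofReal (|secondDiff h u x| ^ q / ‖h‖ ^ (s * q)) ≤ S) →
      ∀ h : Rn N, 0 < ‖h‖ → ‖h‖ < h₀ → h₀ < 1 → ∫⁻ x in ball (0 : Rn N) (R - 4 * h₀),
        ENNReal.ofReal (|secondDiff h u x| ^ (q + 1) / ‖h‖ ^ (s * (q + 1))) ≤ K * (S + 1) := by
  have hsp : 0 < s * p := mul_pos hs0 (by linarith)
  obtain ⟨K₁, hK₁, hd₁⟩ := lintegral_diff_le_of_secondDiff N hs0 hs1 (by linarith : 1 ≤ q) ha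
  obtain ⟨K₂, hK₂, hd₂⟩ := lintegral_local_error_le hN hs0 hs1 hp hq ha
  obtain ⟨K₃, hK₃, hd₃⟩ := lintegral_translate_sub_le N (e := q + 1) (t := s * p) (by linarith)
    hsp.le
  set V := volume (ball (0 : Rn N) 1) with hV
  have hVt : V < ∞ := measure_ball_lt_top
  set F : ℝ≥0∞ := ENNReal.ofReal (2 ^ p * (1 + 2 / a) ^ ((N : ℝ) + s * p)) *
        ((∫⁻ y : Rn N, ENNReal.ofReal (weight ((N : ℝ) + s * p) y)) +
          ENNReal.ofReal (2 ^ ((N : ℝ) + s * p)) * T + T) with hF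
  have hW : ∫⁻ y : Rn N, ENNReal.ofReal (weight ((N : ℝ) + s * p) y) < ∞ :=
    lintegral_weight_lt_top (by linarith)
  have hFt : F < ∞ := ENNReal.mul_lt_top ENNReal.ofReal_lt_top (ENNReal.add_lt_top.mpr
    ⟨ENNReal.add_lt_top.mpr ⟨hW, ENNReal.mul_lt_top ENNReal.ofReal_lt_top hT⟩, hT⟩)
  refine ⟨K₃ * (ENNReal.ofReal (2 ^ (q + 1)) * (K₂ + 2 * (2 * (V + K₁) * F))),
    ENNReal.mul_lt_top hK₃ (ENNReal.mul_lt_top ENNReal.ofReal_lt_top (ENNReal.add_lt_top.mpr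
      ⟨hK₂, ENNReal.mul_lt_top (by simp) (ENNReal.mul_lt_top (ENNReal.mul_lt_top (by simp)
        (ENNReal.add_lt_top.mpr ⟨hVt, hK₁⟩)) hFt)⟩)), ?_⟩
  intro h₀ hah u hu R hR S hS hSd h hh0 hh hh₀1
  have hum := hu.measurable
  have hSd' : ∀ h : Rn N, 0 < ‖h‖ → ‖h‖ < h₀ → ∫⁻ x in ball (0 : Rn N) (R + h₀),
        ENNReal.ofReal (|secondDiff h u x| ^ q / ‖h‖ ^ (s * q)) ≤ S := fun h h1 h2 =>
    (lintegral_mono_set (ball_subset_ball (by linarith))).trans (hSd h h1 h2)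
  set g := s * (q + 1 - p) with hg
  have hfirst : ∫⁻ x in ball (0 : Rn N) (R - 2 * h₀), ENNReal.ofReal
      (|u (x + h) - u x| ^ q / ‖h‖ ^ (s * q)) ≤ K₁ * (S + 1) :=
    (lintegral_mono_set (ball_subset_ball (by linarith))).trans
      (hd₁ h₀ hah u hum hu.bound (R + h₀) (by linarith) S hS hSd' h hh0 hh)
  have hfar : ∫⁻ x in ball (0 : Rn N) (R - 2 * h₀),
      ENNReal.ofReal (|u (x + h) - u x| ^ (q + 3 - p - 1)) ≤
      ENNReal.ofReal (‖h‖ ^ g) * (2 * (V + K₁) * (S + 1)) := by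
    calc _ ≤ ∫⁻ x in ball (0 : Rn N) (R - 2 * h₀), ENNReal.ofReal (‖h‖ ^ g) * (2 *
          (1 + ENNReal.ofReal (|u (x + h) - u x| ^ q / ‖h‖ ^ (s * q)))) := by
          refine setLIntegral_mono (by fun_prop) fun x hx => ?_
          have hw : |u (x + h) - u x| ≤ 2 := (abs_sub _ _).trans (by
            linarith [hu.bound x (ball_subset_ball (by linarith) hx),
              hu.bound (x + h) (add_mem_ball_of_le (by linarith) hx)])
          rw [← ENNReal.ofReal_one, ← ENNReal.ofReal_add (by positivity) (by positivity),
            two_mul_ofReal, ← ENNReal.ofReal_mul (by positivity)]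
          apply ENNReal.ofReal_le_ofReal
          have k1 := abs_rpow_mul_self (t := u (x + h) - u x) (r := q + 1 - p) (by linarith)
          rw [show q + 1 - p + 1 = q + 3 - p - 1 by ring] at k1
          have k2 := rpow_le_one_add_rpow (x := |u (x + h) - u x| / ‖h‖ ^ s) (a := q + 1 - p)
            (b := q) (by positivity) (by linarith) (by linarith)
          rw [Real.div_rpow (abs_nonneg _) (by positivity), Real.div_rpow (abs_nonneg _)
            (by positivity), ← Real.rpow_mul hh0.le, ← Real.rpow_mul hh0.le,
            div_le_iff₀ (by positivity)] at k2
          rw [← k1]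
          calc _ ≤ ((1 + |u (x + h) - u x| ^ q / ‖h‖ ^ (s * q)) * ‖h‖ ^ (s * (q + 1 - p))) * 2 := by
                gcongr
            _ = _ := by rw [hg]; ring
      _ = ENNReal.ofReal (‖h‖ ^ g) * (2 * (volume (ball (0 : Rn N) (R - 2 * h₀)) +
          ∫⁻ x in ball (0 : Rn N) (R - 2 * h₀), ENNReal.ofReal
            (|u (x + h) - u x| ^ q / ‖h‖ ^ (s * q)))) := by
          rw [lintegral_const_mul _ (by fun_prop), lintegral_const_mul _ (by fun_prop),
            lintegral_add_left (by fun_prop), setLIntegral_const, one_mul]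
      _ ≤ _ := by
          rw [mul_assoc 2, add_mul V]
          refine mul_le_mul_right (mul_le_mul_right (add_le_add ?_ hfirst) _) _
          exact (measure_mono (ball_subset_ball (by linarith))).trans
            (le_mul_of_one_le_right' le_add_self)
  -- The exponent `b = q + 3 - p` makes the energy exponent `q + 1`. With `ρ = R - 2h₀` and `d = h₀`
  -- the energy is controlled on radius `R - 3h₀`; the averaging step costs the last `h₀`.
  have hcacc := lintegral_diff_energy_le (b := q + 3 - p) (d := h₀) (ρ := R - 2 * h₀) (R := R) hN
    hs0 hs1 hp (by linarith) hT ha hah (by linarith) hu (h := h) (by linarith) (by linarith)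
  rw [show p + (q + 3 - p) - 2 = q + 1 by ring, ← hF] at hcacc
  have hloc := hd₂ h₀ hah u hum hu.bound R (by linarith) (R - 2 * h₀) S hS hSd' h hh0 hh
  have havg := hd₃ (fun x => u (x + h) - u x) (by fun_prop) h (norm_pos_iff.mp hh0)
    (R - 4 * h₀) h₀ hh.le
  rw [show R - 4 * h₀ + h₀ = R - 2 * h₀ - h₀ by ring] at havg
  have hsd : ∀ x, (u (x + h + h) - u (x + h)) - (u (x + h) - u x) = secondDiff h u x := by
    intro x
    rw [secondDiff, two_smul, ← add_assoc]
    ring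
  simp only [hsd] at havg
  have hpow : 0 < ‖h‖ ^ (s * (q + 1)) := by positivity
  have hexp : ENNReal.ofReal (‖h‖ ^ (s * p)) * ENNReal.ofReal (‖h‖ ^ g) =
      ENNReal.ofReal (‖h‖ ^ (s * (q + 1))) := by
    rw [← ENNReal.ofReal_mul (by positivity), ← Real.rpow_add hh0]
    congr 2
    rw [hg]; ring
  simp_rw [ENNReal.ofReal_div_of_pos hpow, div_eq_mul_inv]
  rw [lintegral_mul_const' _ _ (ENNReal.inv_ne_top.mpr (by simpa using hpow)), ← div_eq_mul_inv,
    ENNReal.div_le_iff (by simpa using hpow) ENNReal.ofReal_ne_top]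
  calc _ ≤ _ := havg
    _ ≤ K₃ * ENNReal.ofReal (‖h‖ ^ (s * p)) * (ENNReal.ofReal (2 ^ (q + 1)) *
        (K₂ * ENNReal.ofReal (‖h‖ ^ g) * (S + 1) +
          2 * (ENNReal.ofReal (‖h‖ ^ g) * (2 * (V + K₁) * (S + 1)) * F))) := by
        refine mul_le_mul_right (hcacc.trans (mul_le_mul_right (add_le_add hloc
          (mul_le_mul_right (mul_le_mul_left hfar _) _)) _)) _
    _ = K₃ * (ENNReal.ofReal (2 ^ (q + 1)) * (K₂ + 2 * (2 * (V + K₁) * F))) * (S + 1) *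
        (ENNReal.ofReal (‖h‖ ^ (s * p)) * ENNReal.ofReal (‖h‖ ^ g)) := by ring
    _ = _ := by rw [hexp]

/-! ### Norms, almost everywhere representatives and reduction to regular solutions. -/

lemma eLpNorm_rpow_eq_lintegral {X : Type*} [MeasurableSpace X] {μ : Measure X} (f : X → ℝ)
    {s q c : ℝ} (hq : 0 < q) (hc : 0 < c) :
    eLpNorm (fun x => f x / c ^ s) (ENNReal.ofReal q) μ ^ q =
      ∫⁻ x, ENNReal.ofReal (|f x| ^ q / c ^ (s * q)) ∂μ := by
  rw [eLpNorm_eq_lintegral_rpow_enorm_toReal (by simpa using hq) ENNReal.ofReal_ne_top,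
    ENNReal.toReal_ofReal hq.le, ← ENNReal.rpow_mul, one_div_mul_cancel hq.ne', ENNReal.rpow_one]
  refine lintegral_congr fun x => ?_
  rw [Real.enorm_eq_ofReal_abs, ENNReal.ofReal_rpow_of_nonneg (abs_nonneg _) hq.le, abs_div,
    Real.div_rpow (abs_nonneg _) (abs_nonneg _), abs_of_nonneg (by positivity : 0 ≤ c ^ s),
    ← Real.rpow_mul hc.le]

lemma ae_eq_translate {N : ℕ} {u v : Rn N → ℝ} (huv : u =ᵐ[volume] v) (h : Rn N) :
    (fun x => u (x + h)) =ᵐ[volume] fun x => v (x + h) :=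
  (measurePreserving_add_right volume h).quasiMeasurePreserving.ae_eq_comp huv

lemma besovSup_congr_ae {N : ℕ} {s q h₀ r : ℝ} {u v : Rn N → ℝ} (huv : u =ᵐ[volume] v) :
    besovSup s q h₀ r u = besovSup s q h₀ r v := by
  unfold besovSup
  refine iSup_congr fun h => iSup_congr fun _ => ?_
  congr 1
  refine eLpNorm_congr_ae (ae_restrict_of_ae ?_)
  filter_upwards [huv, ae_eq_translate huv h, ae_eq_translate huv ((2 : ℝ) • h)] with x h1 h2 h3
  rw [secondDiff, secondDiff, h1, h2, h3]

lemma ae_eq_prod {N : ℕ} {u v : Rn N → ℝ} (huv : u =ᵐ[volume] v) :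
    ∀ᵐ z : Rn N × Rn N, u z.1 = v z.1 ∧ u z.2 = v z.2 := by
  rw [Measure.volume_eq_prod]
  exact (Measure.quasiMeasurePreserving_fst.ae huv).and (Measure.quasiMeasurePreserving_snd.ae huv)

lemma IsLocalWeakSolution.aemeasurable {N : ℕ} {s p : ℝ} {Ω : Set (Rn N)} {u : Rn N → ℝ}
    (hu : IsLocalWeakSolution s p Ω u) : AEMeasurable u := by
  have : AEMeasurable u (volume.restrict (⋃ n : ℕ, closedBall (0 : Rn N) n)) :=
    AEMeasurable.iUnion fun n =>
      (hu.memTailSpace.1 _ (isCompact_closedBall 0 (n : ℝ))).1.aemeasurable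
  rwa [iUnion_closedBall_nat, Measure.restrict_univ] at this

lemma exists_measurable_bounded_ae_eq {X : Type*} [MeasurableSpace X] {μ : Measure X} {u : X → ℝ}
    (hu : AEMeasurable u μ) {B : Set X} (hB : MeasurableSet B)
    (hb : eLpNorm u ∞ (μ.restrict B) ≤ 1) :
    ∃ v : X → ℝ, Measurable v ∧ (∀ x ∈ B, |v x| ≤ 1) ∧ u =ᵐ[μ] v := by
  classical
  refine ⟨B.piecewise (fun x => max (-1) (min 1 (hu.mk u x))) (hu.mk u), ?_, ?_, ?_⟩
  · exact Measurable.piecewise hB (measurable_const.max (measurable_const.min hu.measurable_mk))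
      hu.measurable_mk
  · intro x hx
    rw [piecewise_eq_of_mem _ _ _ hx, abs_le]
    exact ⟨le_max_left _ _, max_le (by norm_num) (min_le_left _ _)⟩
  · have h1 : ∀ᵐ x ∂μ.restrict B, ‖u x‖ₑ ≤ 1 := by
      rw [eLpNorm_exponent_top] at hb
      filter_upwards [enorm_ae_le_eLpNormEssSup u (μ.restrict B)] with x hx
      exact hx.trans hb
    rw [ae_restrict_iff' hB] at h1
    filter_upwards [h1, hu.ae_eq_mk] with x hx hxe
    by_cases hxB : x ∈ B
    · rw [piecewise_eq_of_mem _ _ _ hxB, ← hxe]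
      have h2 := hx hxB
      rw [Real.enorm_eq_ofReal_abs, ENNReal.ofReal_le_one, abs_le] at h2
      rw [min_eq_right h2.2, max_eq_right h2.1]
    · rw [piecewise_eq_of_notMem _ _ _ hxB, hxe]

lemma tail_rpow_eq {N : ℕ} {p α : ℝ} (hp : 1 < p) (u : Rn N → ℝ) :
    tail (p - 1) α u 0 1 ^ (p - 1) =
      ∫⁻ x in (ball (0 : Rn N) 1)ᶜ, ENNReal.ofReal (|u x| ^ (p - 1) / ‖x‖ ^ ((N : ℝ) + α)) := by
  rw [tail, ← ENNReal.rpow_mul, one_div_mul_cancel (by linarith), ENNReal.rpow_one, Real.one_rpow,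
    ENNReal.ofReal_one, one_mul]
  simp

/-- Truncating on the unit ball makes the essential bound pointwise and changes nothing almost
everywhere. Inside the ball the weighted tail is at most the integral of the weight; outside, the
weight is at most the tail kernel. -/
lemma exists_regularSolution {N : ℕ} {s p : ℝ} (hs : 0 < s) (hp : 2 ≤ p) {u : Rn N → ℝ}
    (hu : IsLocalWeakSolution s p (ball 0 2) u)
    (hb : eLpNorm u ∞ (volume.restrict (ball 0 1)) ≤ 1)
    (ht : tail (p - 1) (s * p) u 0 1 ^ (p - 1) ≤ 1) :
    ∃ v : Rn N → ℝ, u =ᵐ[volume] v ∧ RegularSolution s p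
      ((∫⁻ y : Rn N, ENNReal.ofReal (weight ((N : ℝ) + s * p) y)) + 1) v := by
  obtain ⟨v, hvm, hvb, huv⟩ := exists_measurable_bounded_ae_eq hu.aemeasurable measurableSet_ball hb
  have hz := ae_eq_prod huv
  have hsp : 0 < s * p := mul_pos hs (by linarith)
  refine ⟨v, huv, hvm, hvb, ?_, ?_, ?_⟩
  · have h1 := (hu.memWLoc (ball 0 1) isOpen_ball
      ((isCompact_closedBall (0 : Rn N) 1).of_isClosed_subset isClosed_closure
        closure_ball_subset_closedBall)
      (closure_ball_subset_closedBall.trans (closedBall_subset_ball (by norm_num)))).2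
    refine lt_of_eq_of_lt (lintegral_congr_ae (ae_restrict_of_ae ?_)) h1
    filter_upwards [hz] with z hz
    rw [hz.1, hz.2]
  · rw [tail_rpow_eq (by linarith)] at ht
    rw [← lintegral_add_compl _ (measurableSet_ball : MeasurableSet (ball (0 : Rn N) 1))]
    refine add_le_add ?_ (le_trans ?_ ht)
    · refine le_trans (setLIntegral_mono (g := fun y => ENNReal.ofReal
        (weight ((N : ℝ) + s * p) y)) (by fun_prop) fun x hx => ?_) (setLIntegral_le_lintegral _ _)
      apply ENNReal.ofReal_le_ofReal
      exact mul_le_of_le_one_left (weight_nonneg _ _)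
        (Real.rpow_le_one (abs_nonneg _) (hvb x hx) (by linarith))
    · refine setLIntegral_mono_ae' measurableSet_ball.compl ?_
      filter_upwards [huv] with x hx hxB
      rw [hx]
      apply ENNReal.ofReal_le_ofReal
      have hx1 : 1 ≤ ‖x‖ := by
        simpa using hxB
      rw [div_eq_mul_inv, weight, Real.rpow_neg (by positivity)]
      gcongr
      linarith
  · intro φ h1 h2 h3
    rw [← hu.weak_eq φ h1 h2 h3]
    refine integral_congr_ae ?_
    filter_upwards [hz] with z hz
    rw [weakIntegrand, weakIntegrand, hz.1, hz.2]

lemma besovSup_mono_radius {N : ℕ} {s q h₀ r r' : ℝ} (hq : 0 ≤ q) (hr : r ≤ r') (u : Rn N → ℝ) :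
    besovSup s q h₀ r u ≤ besovSup s q h₀ r' u := by
  unfold besovSup
  gcongr

lemma besovSup_succ_le {N : ℕ} (hN : 1 ≤ N) {s p q a : ℝ} (hs0 : 0 < s) (hs1 : s < 1)
    (hp : 2 ≤ p) (hq : p ≤ q) (ha : 0 < a) :
    ∃ K : ℝ≥0∞, K < ∞ ∧ ∀ h₀, a ≤ h₀ → h₀ < 1 / 10 → ∀ u : Rn N → ℝ,
        IsLocalWeakSolution s p (ball 0 2) u →
        eLpNorm u ∞ (volume.restrict (ball 0 1)) ≤ 1 →
        tail (p - 1) (s * p) u 0 1 ^ (p - 1) ≤ 1 →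
        besovSup s q h₀ 1 u < ∞ →
        ∀ R : ℝ, R ≤ 1 - 5 * h₀ →
          besovSup s (q + 1) h₀ (R - 4 * h₀) u ≤ K * (besovSup s q h₀ (R + 4 * h₀) u + 1) := by
  have hq0 : 0 < q := by linarith
  have hsp : 0 < s * p := mul_pos hs0 (by linarith)
  have hW : ∫⁻ y : Rn N, ENNReal.ofReal (weight ((N : ℝ) + s * p) y) < ∞ :=
    lintegral_weight_lt_top (by linarith)
  obtain ⟨K, hK, hd⟩ := lintegral_secondDiff_succ_le hN hs0 hs1 hp hq
    (ENNReal.add_lt_top.mpr ⟨hW, ENNReal.one_lt_top⟩) ha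
  refine ⟨K, hK, fun h₀ hah hh₀ u hu hb ht hS R hR => ?_⟩
  obtain ⟨v, huv, hv⟩ := exists_regularSolution hs0 hp hu hb ht
  rw [besovSup_congr_ae huv, besovSup_congr_ae huv (q := q)]
  rw [besovSup_congr_ae huv] at hS
  refine iSup₂_le fun h hh => ?_
  rw [eLpNorm_rpow_eq_lintegral _ (by linarith) hh.1]
  refine hd h₀ hah v hv R hR _ ((besovSup_mono_radius hq0.le (by linarith) v).trans_lt hS) ?_ h hh.1
    hh.2 (by linarith)
  intro k hk0 hk
  rw [← eLpNorm_rpow_eq_lintegral _ hq0 hk0]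
  exact le_iSup₂ (f := fun (h : Rn N) (_ : 0 < ‖h‖ ∧ ‖h‖ < h₀) =>
    eLpNorm (fun x => secondDiff h v x / ‖h‖ ^ s) (ENNReal.ofReal q)
      (volume.restrict (ball (0 : Rn N) (R + 4 * h₀))) ^ q) k ⟨hk0, hk⟩

/-! ### Choice of the constant and conclusion. -/

/-- Constants that are uniform on each `[a, ∞)` are dominated by a positive antitone function
that blows up at `0`. -/
lemma exists_antitone_majorant (K : ℝ → ℝ≥0∞) (hK : ∀ a, 0 < a → K a < ∞) :
    ∃ C : ℝ → ℝ, (∀ t, 0 < t → 0 < C t) ∧ AntitoneOn C (Ioi 0) ∧ Tendsto C (𝓝[>] 0) atTop ∧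
      ∀ t, 0 < t → ∃ a, 0 < a ∧ a ≤ t ∧ K a ≤ ENNReal.ofReal (C t) := by
  set k : ℕ → ℝ := fun n => (K (1 / ((n : ℝ) + 1))).toReal with hk
  have hk0 : ∀ n, 0 ≤ k n := fun n => ENNReal.toReal_nonneg
  -- Partial sums make `D` monotone and at least each `k n`; the summand `n + 1` forces positivity
  -- and blow-up. Evaluating at `⌈t⁻¹⌉₊` corresponds to `a = 1 / (⌈t⁻¹⌉₊ + 1) ≤ t`.
  set D : ℕ → ℝ := fun n => n + 1 + ∑ i ∈ Finset.range (n + 1), k i with hD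
  have hDm : Monotone D := by
    refine monotone_nat_of_le_succ fun n => ?_
    simp only [hD]
    rw [Finset.sum_range_succ _ (n + 1)]
    push_cast
    linarith [hk0 (n + 1)]
  have hDn : ∀ n : ℕ, (n : ℝ) + 1 ≤ D n := fun n => by
    simp only [hD]
    linarith [Finset.sum_nonneg fun i (_ : i ∈ Finset.range (n + 1)) => hk0 i]
  refine ⟨fun t => D ⌈t⁻¹⌉₊, fun t _ => ?_, ?_, ?_, ?_⟩
  · have := hDn ⌈t⁻¹⌉₊
    positivity
  · intro x hx y hy hxy
    rw [mem_Ioi] at hx hy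
    refine hDm (Nat.ceil_mono ?_)
    gcongr
  · refine tendsto_atTop_mono (fun t => ?_) tendsto_inv_nhdsGT_zero
    linarith [hDn ⌈t⁻¹⌉₊, Nat.le_ceil t⁻¹]
  · intro t ht
    refine ⟨1 / ((⌈t⁻¹⌉₊ : ℝ) + 1), by positivity, ?_, ?_⟩
    · rw [div_le_iff₀ (by positivity)]
      have := mul_le_mul_of_nonneg_left (Nat.le_ceil t⁻¹) ht.le
      rw [mul_inv_cancel₀ ht.ne'] at this
      linarith
    · rw [← ENNReal.ofReal_toReal (hK (1 / ((⌈t⁻¹⌉₊ : ℝ) + 1)) (by positivity)).ne]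
      apply ENNReal.ofReal_le_ofReal
      have h1 := Finset.single_le_sum (fun i (_ : i ∈ Finset.range (⌈t⁻¹⌉₊ + 1)) => hk0 i)
        (Finset.self_mem_range_succ ⌈t⁻¹⌉₊)
      simp only [hD]
      have : (0 : ℝ) ≤ (⌈t⁻¹⌉₊ : ℝ) := Nat.cast_nonneg _
      have h2 : (K (1 / ((⌈t⁻¹⌉₊ : ℝ) + 1))).toReal = k ⌈t⁻¹⌉₊ := rfl
      linarith

end FracPLap

end

theorem proposition4p1 (N : ℕ) (hN : 1 ≤ N) (s p q : ℝ) (hs0 : 0 < s) (hs1 : s < 1)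
    (hp : 2 ≤ p) (hq : p ≤ q) :
    ∃ C : ℝ → ℝ,
      (∀ h₀ ∈ Ioo (0 : ℝ) (1 / 10), 0 < C h₀) ∧
      AntitoneOn C (Ioo (0 : ℝ) (1 / 10)) ∧
      Tendsto C (𝓝[>] 0) atTop ∧
      ∀ h₀ ∈ Ioo (0 : ℝ) (1 / 10), ∀ u : FracPLap.Rn N → ℝ,
        FracPLap.IsLocalWeakSolution s p (ball 0 2) u →
        eLpNorm u ∞ (volume.restrict (ball 0 1)) ≤ 1 →
        FracPLap.tail (p - 1) (s * p) u 0 1 ^ (p - 1) ≤ 1 →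
        FracPLap.besovSup s q h₀ 1 u < ∞ →
        ∀ R : ℝ, 4 * h₀ < R → R ≤ 1 - 5 * h₀ →
          FracPLap.besovSup s (q + 1) h₀ (R - 4 * h₀) u ≤
            ENNReal.ofReal (C h₀) * (FracPLap.besovSup s q h₀ (R + 4 * h₀) u + 1) := by
  choose! K hK hd using fun (a : ℝ) (ha : 0 < a) =>
    FracPLap.besovSup_succ_le hN hs0 hs1 hp hq ha
  obtain ⟨C, hC0, hCa, hCt, hCK⟩ := FracPLap.exists_antitone_majorant K hK
  refine ⟨C, fun h₀ hh => hC0 h₀ hh.1, hCa.mono Ioo_subset_Ioi_self, hCt, ?_⟩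
  intro h₀ hh u hu hb ht hS R _ hR
  obtain ⟨a, ha0, hah, hKC⟩ := hCK h₀ hh.1
  exact (hd a ha0 h₀ hah hh.2 u hu hb ht hS R hR).trans (mul_le_mul_left hKC _)
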